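/- Let $\mathcal H$ be the Hilbert space of a single bosonic mode, that is, a complex Hilbert space with an orthonormal basis $(|n\rangle)_{n\ge 0}$ (the Fock basis), and let $\hat N=\hat a^\dagger\hat a$ be the number operator, where $\hat a|n+1\rangle=\sqrt{n+1}\,|n\rangle$, $\hat a|0\rangle=0$ and $\hat a^\dagger|n\rangle=\sqrt{n+1}\,|n+1\rangle$, so that $\hat N|n\rangle=n|n\rangle$. A state is a positive trace-class operator on $\mathcal H$ of unit trace. For a state $\rho$ let $\operatorname{tr}(\hat N\rho):=\sup_{n}\operatorname{tr}\bigl(\hat N\,1_{[0,n]}(\hat N)\,\rho\bigr)\in[0,\infty]$, where $1_{[0,n]}(\hat N)$ is the spectral projection of $\hat N$ onto energies at most $n$, and let $S(\rho)=-\operatorname{tr}(\rho\log\rho)\in[0,\infty]$ be its von Neumann entropy. Let $h(x)=-x\log x-(1-x)\log(1-x)$ be the binary entropy, with $0\log 0=0$ and natural logarithms, and let $\|\cdot\|_1$ be the trace norm. Theorem 3.3 (von Neumann entropy continuity bound). Let $0<E<\infty$ and $\varepsilon\in[0,E/(E+1)]$. If $\rho,\sigma$ are states on $\mathcal H$ with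 $\operatorname{tr}(\hat N\rho)\le E$, $\operatorname{tr}(\hat N\sigma)\le E$ and $\tfrac12\|\rho-\sigma\|_1\le\varepsilon$, then $S(\rho)$ and $S(\sigma)$ are finite and $$|S(\rho)-S(\sigma)|\le h(\varepsilon)+E\,h(\varepsilon/E).$$ Moreover, for every $0<E<\infty$ and every $\varepsilon\in[0,E/(E+1)]$ the inequality is tight: there are states $\rho,\sigma$ on $\mathcal H$ with $\operatorname{tr}(\hat N\rho)\le E$, $\operatorname{tr}(\hat N\sigma)\le E$, $\tfrac12\|\rho-\sigma\|_1=\varepsilon$, finite entropies, and $|S(\rho)-S(\sigma)|=h(\varepsilon)+E\,h(\varepsilon/E)$. -/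

import Mathlib

open scoped ENNReal InnerProductSpace

noncomputable section

namespace BosonicMode

variable {H : Type*} [NormedAddCommGroup H] [InnerProductSpace ℂ H]

/-! ### The number operator of a single mode

`H` is the Hilbert space of the mode and `b` its Fock basis `|0⟩, |1⟩, |2⟩, …`. -/

/-- The (in general unbounded) operator `ψ ↦ ∑ₙ (c ψ)ₙ |n⟩`, on its maximal domain: the vectors `ψ`
for which the sequence `c ψ` is square summable. -/
def ofCoeffs (b : HilbertBasis ℕ ℂ H) (c : H →ₗ[ℂ] (ℕ → ℂ)) : H →ₗ.[ℂ] H where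
  domain :=
    { carrier := {ψ | Memℓp (c ψ) 2}
      add_mem' := fun {x y} (hx : Memℓp (c x) 2) (hy : Memℓp (c y) 2) => by
        show Memℓp (c (x + y)) 2
        rw [map_add]; exact hx.add hy
      zero_mem' := by
        show Memℓp (c 0) 2
        rw [map_zero]; exact zero_memℓp
      smul_mem' := fun k x (hx : Memℓp (c x) 2) => by
        show Memℓp (c (k • x)) 2
        rw [map_smul]; exact hx.const_smul k }
  toFun :=
    { toFun := fun ψ => b.repr.symm ⟨c ψ, ψ.2⟩
      map_add' := fun x y => by
        rw [← map_add]; congr 1; ext n; simp; rfl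
      map_smul' := fun k x => by
        rw [RingHom.id_apply, ← map_smul]; congr 1; ext n; simp }

/-- The annihilation operator: `⟨n| a ψ⟩ = √(n+1) ⟨n+1|ψ⟩`, that is, `a |n+1⟩ = √(n+1) |n⟩` and
`a |0⟩ = 0`. -/
def annihilation (b : HilbertBasis ℕ ℂ H) : H →ₗ.[ℂ] H :=
  ofCoeffs b
    { toFun := fun ψ n => (√((n : ℝ) + 1) : ℂ) * ⟪b (n + 1), ψ⟫_ℂ
      map_add' := fun x y => by ext n; simp [mul_add]
      map_smul' := fun k x => by ext n; simp [mul_left_comm] }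

/-- The creation operator: `⟨n| a† ψ⟩ = √n ⟨n-1|ψ⟩`, that is, `a† |n⟩ = √(n+1) |n+1⟩`.
(At `n = 0` the coefficient is `0`, because of the factor `√0`.) -/
def creation (b : HilbertBasis ℕ ℂ H) : H →ₗ.[ℂ] H :=
  ofCoeffs b
    { toFun := fun ψ n => (√(n : ℝ) : ℂ) * ⟪b (n - 1), ψ⟫_ℂ
      map_add' := fun x y => by ext n; simp [mul_add]
      map_smul' := fun k x => by ext n; simp [mul_left_comm] }

/-- The composition `A B` of two unbounded operators, on its natural domain: the vectors `ψ` in the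
domain of `B` for which `B ψ` lies in the domain of `A`. -/
def pcomp (A B : H →ₗ.[ℂ] H) : H →ₗ.[ℂ] H where
  domain := (A.domain.comap B.toFun).map B.domain.subtype
  toFun :=
    { toFun := fun ψ =>
        A ⟨B ⟨ψ, by obtain ⟨_, y, _, rfl⟩ := ψ; exact y.2⟩, by
          obtain ⟨_, y, hy, rfl⟩ := ψ; exact hy⟩
      map_add' := fun x y => by
        rw [← A.map_add]; congr 1; ext; simp only [Submodule.coe_add]; rw [← B.map_add]; rfl
      map_smul' := fun k x => by
        rw [RingHom.id_apply, ← A.map_smul]; congr 1; ext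
        simp only [Submodule.coe_smul]; rw [← B.map_smul]; rfl }

/-- The number operator `N = a† a`. -/
def numberOp (b : HilbertBasis ℕ ℂ H) : H →ₗ.[ℂ] H :=
  pcomp (creation b) (annihilation b)

/-- For a positive operator `A` with pure point spectrum, the range of the spectral projection of
`A` onto the energies in `[0, n]`: the closed linear span of the eigenvectors with eigenvalue in
`[0, n]`. -/
def spectralSubspace (A : H →ₗ.[ℂ] H) (n : ℕ) : Submodule ℂ H :=
  (Submodule.span ℂ
    {ψ | ∃ (h : ψ ∈ A.domain) (t : ℝ), 0 ≤ t ∧ t ≤ n ∧ A ⟨ψ, h⟩ = (t : ℂ) • ψ}).topologicalClosure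

lemma inner_ofCoeffs (b : HilbertBasis ℕ ℂ H) (c : H →ₗ[ℂ] (ℕ → ℂ)) (ψ : (ofCoeffs b c).domain)
    (n : ℕ) : ⟪b n, ofCoeffs b c ψ⟫_ℂ = c ψ n := by
  rw [← b.repr_apply_apply]
  show b.repr (b.repr.symm ⟨c ψ, ψ.2⟩) n = _
  simp

lemma inner_numberOp (b : HilbertBasis ℕ ℂ H) (ψ : (numberOp b).domain) (n : ℕ) :
    ⟪b n, numberOp b ψ⟫_ℂ = n * ⟪b n, (ψ : H)⟫_ℂ := by
  refine (inner_ofCoeffs b _ _ n).trans ?_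
  show (√(n : ℝ) : ℂ) * ⟪b (n - 1), annihilation b _⟫_ℂ = _
  rcases n with _ | n
  · simp
  · rw [Nat.add_sub_cancel]
    refine (congrArg _ (inner_ofCoeffs b _ _ n)).trans ?_
    show (√((n + 1 : ℕ) : ℝ) : ℂ) * ((√((n : ℝ) + 1) : ℂ) * ⟪b (n + 1), (ψ : H)⟫_ℂ) = _
    rw [← mul_assoc, Nat.cast_succ, ← Complex.ofReal_mul, Real.mul_self_sqrt (by positivity)]
    push_cast; rfl

lemma memℓp_of_finite_support {f : ℕ → ℂ} (m : ℕ) (hf : ∀ n, m ≤ n → f n = 0) : Memℓp f 2 := by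
  refine memℓp_gen (summable_of_ne_finset_zero (s := Finset.range m) fun n hn => ?_)
  rw [hf n (by simpa using hn)]; simp

lemma basis_mem_domain (b : HilbertBasis ℕ ℂ H) (k : ℕ) : b k ∈ (numberOp b).domain := by
  have h1 : b k ∈ (annihilation b).domain := by
    refine memℓp_of_finite_support k fun n hn => ?_
    show (√((n : ℝ) + 1) : ℂ) * ⟪b (n + 1), b k⟫_ℂ = 0
    rw [b.orthonormal.inner_eq_zero (by omega), mul_zero]
  refine ⟨⟨b k, h1⟩, ?_, rfl⟩
  refine memℓp_of_finite_support (k + 1) fun n hn => ?_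
  show (√(n : ℝ) : ℂ) * ⟪b (n - 1), annihilation b ⟨b k, h1⟩⟫_ℂ = 0
  refine (congrArg _ (inner_ofCoeffs b _ _ (n - 1))).trans ?_
  show (√(n : ℝ) : ℂ) * (_ * ⟪b (n - 1 + 1), b k⟫_ℂ) = 0
  rw [b.orthonormal.inner_eq_zero (by omega), mul_zero, mul_zero]

lemma numberOp_basis (b : HilbertBasis ℕ ℂ H) (k : ℕ) :
    numberOp b ⟨b k, basis_mem_domain b k⟩ = (k : ℂ) • b k := by
  apply b.repr.injective
  ext n
  rw [b.repr_apply_apply, inner_numberOp, b.repr_apply_apply, inner_smul_right]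
  by_cases h : n = k
  · rw [h]
  · simp [b.orthonormal.inner_eq_zero h]

lemma spectralSubspace_numberOp (b : HilbertBasis ℕ ℂ H) (n : ℕ) :
    spectralSubspace (numberOp b) n = Submodule.span ℂ (b '' Set.Iic n) := by
  have key : Submodule.span ℂ {ψ | ∃ (h : ψ ∈ (numberOp b).domain) (t : ℝ),
      0 ≤ t ∧ t ≤ n ∧ numberOp b ⟨ψ, h⟩ = (t : ℂ) • ψ} = Submodule.span ℂ (b '' Set.Iic n) := by
    apply le_antisymm <;> rw [Submodule.span_le]
    · rintro ψ ⟨h, t, -, ht, e⟩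
      have hc : ∀ k, n < k → ⟪b k, ψ⟫_ℂ = 0 := fun k hk => by
        have h2 := inner_numberOp b ⟨ψ, h⟩ k
        rw [e, inner_smul_right] at h2
        have h3 : ((t : ℂ) - k) * ⟪b k, ψ⟫_ℂ = 0 := by rw [sub_mul, h2]; simp
        rcases mul_eq_zero.1 h3 with h4 | h4
        · have h5 : t = k := by exact_mod_cast sub_eq_zero.1 h4
          have h6 : (n : ℝ) < k := by exact_mod_cast hk
          linarith
        · exact h4
      have hs := (b.hasSum_repr ψ).unique (hasSum_sum_of_ne_finset_zero
        (s := Finset.range (n + 1)) fun k hk => by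
          rw [b.repr_apply_apply, hc k (by simpa using hk), zero_smul])
      rw [hs]
      refine Submodule.sum_mem _ fun k hk => Submodule.smul_mem _ _ (Submodule.subset_span ?_)
      exact ⟨k, by simpa [Nat.lt_succ_iff] using hk, rfl⟩
    · rintro _ ⟨k, hk, rfl⟩
      refine Submodule.subset_span ⟨basis_mem_domain b k, k, by positivity, ?_, ?_⟩
      · exact_mod_cast hk
      · rw [numberOp_basis]; simp
  have : FiniteDimensional ℂ (Submodule.span ℂ (b '' Set.Iic n)) :=
    FiniteDimensional.span_of_finite ℂ ((Set.finite_Iic n).image b)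
  rw [spectralSubspace, key]
  exact (Submodule.closed_of_finiteDimensional _).submodule_topologicalClosure_eq

lemma spectralSubspace_le_domain (b : HilbertBasis ℕ ℂ H) (n : ℕ) :
    spectralSubspace (numberOp b) n ≤ (numberOp b).domain := by
  rw [spectralSubspace_numberOp, Submodule.span_le]
  rintro _ ⟨k, -, rfl⟩
  exact basis_mem_domain b k

instance [CompleteSpace H] (A : H →ₗ.[ℂ] H) (n : ℕ) :
    (spectralSubspace A n).HasOrthogonalProjection := by
  have : CompleteSpace (spectralSubspace A n) :=
    (Submodule.isClosed_topologicalClosure _).completeSpace_coe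
  infer_instance

variable [CompleteSpace H]

/-- The truncated number operator `N 1_{[0, n]}(N)`: first apply the spectral projection of `N` onto
the energies in `[0, n]`, then `N`. -/
def numberOpTrunc (b : HilbertBasis ℕ ℂ H) (n : ℕ) : H →ₗ[ℂ] H :=
  (numberOp b).toFun ∘ₗ
    LinearMap.codRestrict (numberOp b).domain
      ((spectralSubspace (numberOp b) n).starProjection : H →ₗ[ℂ] H)
      fun ψ => spectralSubspace_le_domain b n (Submodule.starProjection_apply_mem _ ψ)

/-! ### Traces, states, energy, entropy

Traces are computed in the basis `b`; on trace class operators and on positive operators the value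
does not depend on the basis. -/

/-- The trace `∑ₙ ⟨n| T |n⟩` (of a trace class operator). -/
def tr (b : HilbertBasis ℕ ℂ H) (T : H →ₗ[ℂ] H) : ℂ :=
  ∑' n, ⟪b n, T (b n)⟫_ℂ

/-- The trace of a positive bounded operator, with values in `[0, ∞]`. -/
def posTr (b : HilbertBasis ℕ ℂ H) (T : H →L[ℂ] H) : ℝ≥0∞ :=
  ∑' n, ENNReal.ofReal (⟪b n, T (b n)⟫_ℂ).re

/-- The trace norm `‖T‖₁ = tr |T|`, with `|T| = √(T† T)`; it is `∞` if `T` is not trace class. -/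
def traceNorm (b : HilbertBasis ℕ ℂ H) (T : H →L[ℂ] H) : ℝ≥0∞ :=
  posTr b (CFC.abs T)

/-- A state (density operator): a positive operator of trace one. -/
structure IsState (b : HilbertBasis ℕ ℂ H) (ρ : H →L[ℂ] H) : Prop where
  pos : ρ.IsPositive
  trace_eq_one : posTr b ρ = 1

/-- The energy `tr (N ρ) = sup_n tr (N 1_{[0, n]}(N) ρ)`, with values in `[0, ∞]`. -/
def energy (b : HilbertBasis ℕ ℂ H) (ρ : H →L[ℂ] H) : ℝ≥0∞ :=
  ⨆ n : ℕ, ENNReal.ofReal (tr b (numberOpTrunc b n ∘ₗ (ρ : H →ₗ[ℂ] H))).re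

/-- The von Neumann entropy `S(ρ) = -tr (ρ log ρ)` of a state, with values in `[0, ∞]`. The positive
operator `-ρ log ρ` is given by the continuous functional calculus for `x ↦ -x log x`, which is `0`
at `x = 0`. -/
def vonNeumannEntropy (b : HilbertBasis ℕ ℂ H) (ρ : H →L[ℂ] H) : ℝ≥0∞ :=
  posTr b (cfc Real.negMulLog ρ)

end BosonicMode

end

namespace BosonicMode

open Real Filter Topology

universe u

/-! ### Sequences with dominated tails -/

/-! The problem reduces to decreasing eigenvalue sequences `p` of ρ and `q` of σ. A positive
operator of finite trace is compact, hence diagonalizable, and its entropy is the Shannon entropy of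
its spectrum. By Ky Fan's principle `p` has mean at most `E`, and the trace-norm bound gives
`∑_{i<k} q i ≤ ∑_{i<k} p i + ε` for all `k`.

The classical statement is `shannonEntropy_le_add`. Move mass ε (or all that is available) from the
far end of `p` to position 0. The result `s` majorizes `q`, so its entropy is at most that of `q`.
The entropy lost from `p` to `s` is at most `η(1 - d) + ∑ η(r n)`, where `η = negMulLog` and `r` is
the moved mass, of total `d ≤ ε` and first moment at most `E`. Comparing `r` with the geometric
weights of mass ε and first moment `E` on the positive integers, whose logarithm is affine in the
position, bounds this by an affine function of `d` and of the first moment. That function is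
nondecreasing in `d` because `ε ≤ E / (E + 1)`, and at `d = ε` with first moment `E` it is the
claimed bound (`gain_le`).

For the vacuum and the state with spectrum `1 - ε` followed by these geometric weights, the bound is
attained. -/

lemma tsum_ite_lt_eq_tsum_nat_add (u : ℕ → ℝ≥0∞) (k : ℕ) :
    ∑' n, (if k < n then u n else 0) = ∑' i, u (i + (k + 1)) := by
  rw [← ENNReal.summable.sum_add_tsum_nat_add' (k := k + 1)]
  · rw [Finset.sum_eq_zero, zero_add]
    · refine tsum_congr fun i => if_pos (by omega)
    · intro i hi
      rw [Finset.mem_range] at hi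
      exact if_neg (by omega)

/-- Abel summation: write `a n` as `a 0` plus its increments and exchange the sums, which is free in
`[0, ∞]`. The weights may reach `∞`; monotonicity keeps truncated subtraction harmless. -/
lemma tsum_mul_eq_tsum_tail {a : ℕ → ℝ≥0∞} (ha : Monotone a) (u : ℕ → ℝ≥0∞) :
    ∑' n, a n * u n = a 0 * ∑' n, u n + ∑' k, (a (k + 1) - a k) * ∑' i, u (i + (k + 1)) := by
  have h1 : ∀ n, a n = a 0 + ∑ k ∈ Finset.range n, (a (k + 1) - a k) := by
    intro n
    induction n with
    | zero => simp
    | succ n ih =>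
      rw [Finset.sum_range_succ, ← add_assoc, ← ih, add_tsub_cancel_of_le (ha (Nat.le_succ n))]
  have h2 : ∀ n, a n * u n
      = a 0 * u n + ∑' k, (a (k + 1) - a k) * (if k < n then u n else 0) := by
    intro n
    rw [tsum_eq_sum (s := Finset.range n) fun k hk => by
      rw [if_neg (by simpa using hk), mul_zero]]
    conv_lhs => rw [h1 n, add_mul, Finset.sum_mul]
    congr 1
    refine Finset.sum_congr rfl fun k hk => ?_
    rw [if_pos (by simpa using hk)]
  rw [tsum_congr h2, ENNReal.tsum_add, ENNReal.tsum_mul_left, ENNReal.tsum_comm]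
  congr 1
  refine tsum_congr fun k => ?_
  rw [ENNReal.tsum_mul_left, tsum_ite_lt_eq_tsum_nat_add]

/-- If the tails of `u` are dominated by those of `v`, then so are its sums against increasing
weights. -/
lemma tsum_mul_le_of_tail_le {a u v : ℕ → ℝ≥0∞} (ha : Monotone a)
    (h : ∀ k, ∑' i, u (i + k) ≤ ∑' i, v (i + k)) :
    ∑' n, a n * u n ≤ ∑' n, a n * v n := by
  rw [tsum_mul_eq_tsum_tail ha, tsum_mul_eq_tsum_tail ha]
  exact add_le_add (mul_le_mul_right (h 0) _)
    (ENNReal.tsum_le_tsum fun k => mul_le_mul_right (h (k + 1)) _)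

/-! ### Elementary inequalities for `-x log x` -/

/-- The concave function lies below its tangent at `c`. This is the pointwise form of Gibbs'
inequality, with `c` as reference weight. -/
lemma negMulLog_le_of_pos {x c : ℝ} (hx : 0 ≤ x) (hc : 0 < c) :
    negMulLog x ≤ -x * log c + c - x := by
  rcases hx.eq_or_lt with rfl | hx
  · simpa using hc.le
  · have h := log_le_sub_one_of_pos (div_pos hc hx)
    rw [log_div hc.ne' hx.ne'] at h
    have h2 := mul_le_mul_of_nonneg_left h hx.le
    have h3 : x * (c / x - 1) = c - x := by field_simp
    rw [h3] at h2
    rw [negMulLog]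
    linarith

lemma negMulLog_add_le {x y : ℝ} (hx : 0 ≤ x) (hy : 0 ≤ y) :
    negMulLog (x + y) ≤ negMulLog x + negMulLog y := by
  rcases hx.eq_or_lt with rfl | hx
  · simp
  rcases hy.eq_or_lt with rfl | hy
  · simp
  have h1 := mul_le_mul_of_nonneg_left (log_le_log hx (le_add_of_nonneg_right hy.le)) hx.le
  have h2 := mul_le_mul_of_nonneg_left (log_le_log hy (le_add_of_nonneg_left hx.le)) hy.le
  simp only [negMulLog]
  linarith

/-- With `l = d / (1 - x)`, the points `x + d` and `1 - d` are convex combinations of `x` and `1`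
with weights swapped. Concavity at both, with `negMulLog 1 = 0`, gives `(1 - l)` and `l` times the
left side. -/
lemma negMulLog_le_add_one_sub {x d : ℝ} (hx : 0 ≤ x) (hd : 0 ≤ d) (h : x + d ≤ 1) :
    negMulLog x ≤ negMulLog (x + d) + negMulLog (1 - d) := by
  rcases (show x ≤ 1 by linarith).eq_or_lt with rfl | hx1
  · obtain rfl : d = 0 := by linarith
    simp
  have h0 : 0 < 1 - x := by linarith
  have hl0 : 0 ≤ d / (1 - x) := by positivity
  have hl1 : d / (1 - x) ≤ 1 := by rw [div_le_one h0]; linarith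
  have hdl : d / (1 - x) * (1 - x) = d := div_mul_cancel₀ _ h0.ne'
  generalize d / (1 - x) = l at *
  have c1 := concaveOn_negMulLog.2 (Set.mem_Ici.2 hx)
    (Set.mem_Ici.2 zero_le_one) (show 0 ≤ 1 - l by linarith) hl0 (by ring)
  have c2 := concaveOn_negMulLog.2 (Set.mem_Ici.2 hx)
    (Set.mem_Ici.2 zero_le_one) hl0 (show 0 ≤ 1 - l by linarith) (by ring)
  simp only [smul_eq_mul, negMulLog_one, mul_zero, add_zero, mul_one] at c1 c2
  rw [show (1 - l) * x + l = x + d by rw [← hdl]; ring] at c1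
  rw [show l * x + (1 - l) = 1 - d by rw [← hdl]; ring] at c2
  linarith

/-! ### Shannon entropy -/

/-- The Shannon entropy of a sequence of weights, with values in `[0, ∞]`. -/
noncomputable def shannonEntropy (p : ℕ → ℝ) : ℝ≥0∞ :=
  ∑' n, ENNReal.ofReal (negMulLog (p n))

/-- A decreasing probability distribution on `ℕ`. -/
structure IsSortedDistribution (p : ℕ → ℝ) : Prop where
  nonneg : ∀ n, 0 ≤ p n
  antitone : Antitone p
  hasSum : HasSum p 1

lemma hasSum_tail {p : ℕ → ℝ} (hp : HasSum p 1) (k : ℕ) :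
    HasSum (fun i => p (i + k)) (1 - ∑ i ∈ Finset.range k, p i) :=
  (hasSum_nat_add_iff' k).2 hp

lemma tsum_ofReal_tail {p : ℕ → ℝ} (hp0 : ∀ n, 0 ≤ p n) (hp : HasSum p 1) (k : ℕ) :
    ∑' i, ENNReal.ofReal (p (i + k)) = ENNReal.ofReal (1 - ∑ i ∈ Finset.range k, p i) := by
  rw [← (hasSum_tail hp k).tsum_eq,
    ENNReal.ofReal_tsum_of_nonneg (fun i => hp0 _) (hasSum_tail hp k).summable]

/-- Gibbs' inequality. -/
lemma shannonEntropy_le_tsum_neg_log {p q : ℕ → ℝ} (hp0 : ∀ n, 0 ≤ p n) (hp : HasSum p 1)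
    (hq0 : ∀ n, 0 ≤ q n) (hq : HasSum q 1) :
    shannonEntropy p ≤ ∑' n, (if q n = 0 then ∞ else ENNReal.ofReal (-log (q n)))
      * ENNReal.ofReal (p n) := by
  have hp1 : ∀ n, p n ≤ 1 := fun n => le_hasSum hp n fun i _ => hp0 i
  have hq1 : ∀ n, q n ≤ 1 := fun n => le_hasSum hq n fun i _ => hq0 i
  have key : ∀ n, ENNReal.ofReal (negMulLog (p n)) + ENNReal.ofReal (p n)
      ≤ (if q n = 0 then ∞ else ENNReal.ofReal (-log (q n))) * ENNReal.ofReal (p n)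
        + ENNReal.ofReal (q n) := by
    intro n
    -- Where `q n = 0` the weight is `∞`, and `∞ * 0 = 0` covers `p n = 0`.
    split_ifs with h
    · rcases (hp0 n).eq_or_lt with h0 | h0
      · simp [← h0]
      · rw [ENNReal.top_mul (by simpa using h0)]; simp
    · have hqn : 0 < q n := lt_of_le_of_ne (hq0 n) (Ne.symm h)
      have hl : 0 ≤ -log (q n) := neg_nonneg.2 (log_nonpos (hq0 n) (hq1 n))
      rw [← ENNReal.ofReal_mul hl, ← ENNReal.ofReal_add (negMulLog_nonneg (hp0 n) (hp1 n)) (hp0 n),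
        ← ENNReal.ofReal_add (mul_nonneg hl (hp0 n)) (hq0 n)]
      apply ENNReal.ofReal_le_ofReal
      have := negMulLog_le_of_pos (hp0 n) hqn
      linarith
  have h2 := ENNReal.tsum_le_tsum key
  rw [ENNReal.tsum_add, ENNReal.tsum_add] at h2
  have e1 := tsum_ofReal_tail hp0 hp 0
  have e2 := tsum_ofReal_tail hq0 hq 0
  simp only [add_zero, Finset.range_zero, Finset.sum_empty, sub_zero, ENNReal.ofReal_one] at e1 e2
  rw [e1, e2] at h2
  exact (ENNReal.add_le_add_iff_right ENNReal.one_ne_top).1 h2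

/-- Schur concavity of the entropy: a distribution whose tails are dominated by those of a
decreasing distribution has smaller entropy. -/
lemma shannonEntropy_le_of_tail_le {p q : ℕ → ℝ} (hp0 : ∀ n, 0 ≤ p n) (hp : HasSum p 1)
    (hq : IsSortedDistribution q)
    (h : ∀ k, ∑ i ∈ Finset.range k, q i ≤ ∑ i ∈ Finset.range k, p i) :
    shannonEntropy p ≤ shannonEntropy q := by
  -- The weights `-log (q n)` increase because `q` decreases, so tail domination allows replacing
  -- `p` by `q` in the Gibbs bound, which leaves the entropy of `q`.
  refine (shannonEntropy_le_tsum_neg_log hp0 hp hq.nonneg hq.hasSum).trans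
    ((tsum_mul_le_of_tail_le (v := fun n => ENNReal.ofReal (q n)) ?_ fun k => ?_).trans ?_)
  · intro m n hmn
    have hm := hq.antitone hmn
    dsimp only
    split_ifs with h1 h2 h2
    · exact le_rfl
    · rw [h1] at hm
      exact absurd (le_antisymm hm (hq.nonneg n)) h2
    · exact le_top
    · refine ENNReal.ofReal_le_ofReal (neg_le_neg (log_le_log ?_ hm))
      exact lt_of_le_of_ne (hq.nonneg n) (Ne.symm h2)
  · rw [tsum_ofReal_tail hp0 hp, tsum_ofReal_tail hq.nonneg hq.hasSum]
    exact ENNReal.ofReal_le_ofReal (by linarith [h k])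
  · refine ENNReal.tsum_le_tsum fun n => ?_
    split_ifs with h1
    · simp [h1]
    · have hq1 : q n ≤ 1 := le_hasSum hq.hasSum n fun i _ => hq.nonneg i
      rw [← ENNReal.ofReal_mul (neg_nonneg.2 (log_nonpos (hq.nonneg n) hq1))]
      refine ENNReal.ofReal_le_ofReal (le_of_eq ?_)
      rw [negMulLog]; ring

/-- The entropy of a distribution with finite mean is finite. -/
lemma shannonEntropy_ne_top {p : ℕ → ℝ} (hp : IsSortedDistribution p)
    (hm : Summable fun n : ℕ => (n : ℝ) * p n) : shannonEntropy p ≠ ∞ := by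
  -- Tangents at the reference weights `2⁻ⁿ` turn the entropy into the mean times `log 2`, up to a
  -- convergent series.
  have hs : Summable fun n : ℕ => (n : ℝ) * p n * log 2 + (1 / 2 : ℝ) ^ n :=
    (hm.mul_right _).add (summable_geometric_of_lt_one (by norm_num) (by norm_num))
  have hle : ∀ n, negMulLog (p n) ≤ (n : ℝ) * p n * log 2 + (1 / 2 : ℝ) ^ n := by
    intro n
    have h := negMulLog_le_of_pos (hp.nonneg n) (show (0 : ℝ) < (1 / 2) ^ n by positivity)
    rw [log_pow, one_div, log_inv] at h
    have := hp.nonneg n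
    rw [one_div]
    linarith
  refine ne_top_of_le_ne_top (b := ∑' n : ℕ, ENNReal.ofReal ((n : ℝ) * p n * log 2 + (1 / 2 : ℝ) ^ n))
    ?_ (ENNReal.tsum_le_tsum fun n => ENNReal.ofReal_le_ofReal (hle n))
  rw [← ENNReal.ofReal_tsum_of_nonneg (fun n => ?_) hs]
  · exact ENNReal.ofReal_ne_top
  · have := hp.nonneg n
    have := log_nonneg (show (1 : ℝ) ≤ 2 by norm_num)
    positivity

/-- The right-hand side of the continuity bound, as the entropy increment of a geometric
distribution on the positive integers. -/
lemma binEntropy_add_mul_binEntropy_div {E ε : ℝ} (hE : 0 < E) (hε : 0 < ε) :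
    binEntropy ε + E * binEntropy (ε / E)
      = -(1 - ε) * log (1 - ε) - ε * log (ε ^ 2 / E) - (E - ε) * log (1 - ε / E) := by
  rw [binEntropy_eq_negMulLog_add_negMulLog_one_sub,
    binEntropy_eq_negMulLog_add_negMulLog_one_sub]
  simp only [negMulLog]
  rw [log_div hε.ne' hE.ne', log_div (pow_ne_zero 2 hε.ne') hE.ne', log_pow]
  field_simp
  push_cast
  ring

/-- The left side is affine in `d` and `M`, nondecreasing in each, and equals the right side at `d =
ε`, `M = E`. -/
lemma gain_le {E ε d M : ℝ} (hE : 0 < E) (hε : 0 < ε) (hε1 : ε ≤ E / (E + 1))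
    (hdε : d ≤ ε) (hM : M ≤ E) :
    -(1 - d) * log (1 - ε) + (1 - ε) - (1 - d)
      + (-d * log (ε ^ 2 / E) - log (1 - ε / E) * (M - d) + ε - d)
      ≤ binEntropy ε + E * binEntropy (ε / E) := by
  have h1 : ε * (E + 1) ≤ E := (le_div_iff₀ (by linarith)).1 hε1
  have h2 : ε < 1 := by nlinarith
  have h3 : ε < E := by nlinarith
  have hx0 : 0 < 1 - ε / E := by rw [sub_pos, div_lt_one hE]; exact h3
  have hx1 : log (1 - ε / E) ≤ 0 := log_nonpos hx0.le (by have := div_pos hε hE; linarith)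
  have hc : 0 < ε ^ 2 / E := by positivity
  -- The slope in `d` is nonnegative exactly when `ε² ≤ (1 - ε)(E - ε)`, that is `ε (E + 1) ≤ E`:
  -- the origin of the threshold.
  have hlog : log (ε ^ 2 / E) ≤ log (1 - ε) + log (1 - ε / E) := by
    rw [← log_mul (by linarith) hx0.ne']
    apply log_le_log hc
    rw [div_le_iff₀ hE]
    have : (1 - ε) * (1 - ε / E) * E = (1 - ε) * (E - ε) := by field_simp
    rw [this]; nlinarith
  rw [binEntropy_add_mul_binEntropy_div hE hε]
  nlinarith [mul_nonneg (sub_nonneg.2 hdε) (sub_nonneg.2 hlog),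
    mul_nonneg (sub_nonneg.2 hM) (neg_nonneg.2 hx1)]

/-- The entropy continuity bound for decreasing distributions. -/
theorem shannonEntropy_le_add {p q : ℕ → ℝ} (hp : IsSortedDistribution p)
    (hq : IsSortedDistribution q) {E ε : ℝ} (hE : 0 < E) (hε0 : 0 ≤ ε) (hε1 : ε ≤ E / (E + 1))
    (hm : Summable fun n : ℕ => (n : ℝ) * p n) (hmE : ∑' n : ℕ, (n : ℝ) * p n ≤ E)
    (h : ∀ k, ∑ i ∈ Finset.range k, q i ≤ ∑ i ∈ Finset.range k, p i + ε) :
    shannonEntropy p ≤ shannonEntropy q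
      + ENNReal.ofReal (binEntropy ε + E * binEntropy (ε / E)) := by
  rcases hε0.eq_or_lt with rfl | hε
  · refine (shannonEntropy_le_of_tail_le hp.nonneg hp.hasSum hq (by simpa using h)).trans ?_
    exact le_self_add
  have hε1' : ε * (E + 1) ≤ E := (le_div_iff₀ (by linarith)).1 hε1
  have hεlt1 : ε < 1 := by nlinarith
  have hεE : ε < E := by nlinarith
  have hx0 : 0 < 1 - ε / E := by rw [sub_pos, div_lt_one hE]; exact hεE
  have hx1 : 1 - ε / E < 1 := by have := div_pos hε hE; linarith
  -- the tails of `p`, and of the distribution obtained from `p` by moving mass from the tail to `0`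
  set T : ℕ → ℝ := fun k => 1 - ∑ i ∈ Finset.range k, p i with hT
  -- Tail 0 is exempt from the cut, so the total mass stays 1.
  set Ts : ℕ → ℝ := fun k => if k = 0 then 1 else max (T k - ε) 0 with hTs
  set s : ℕ → ℝ := fun k => Ts k - Ts (k + 1) with hs
  have hTsucc : ∀ k, T k - T (k + 1) = p k := fun k => by
    simp only [hT, Finset.sum_range_succ]; ring
  have hT1 : T 1 ≤ 1 := by have := hp.nonneg 0; simp [hT, this]
  have hTs1 : ∀ k, Ts (k + 1) = max (T (k + 1) - ε) 0 := fun k => if_neg (by omega)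
  have hTs0 : Ts 0 = 1 := if_pos rfl
  have hs0 : ∀ k, 0 ≤ s k := by
    rintro (_ | k)
    · simp only [hs, hTs0, hTs1, sub_nonneg]
      exact max_le (by linarith) zero_le_one
    · simp only [hs, hTs1, sub_nonneg]
      refine max_le_max ?_ le_rfl
      have := hTsucc (k + 1); have := hp.nonneg (k + 1); linarith
  have hsp : ∀ k, s (k + 1) ≤ p (k + 1) := by
    intro k
    have h1 := hTsucc (k + 1); have h2 := hp.nonneg (k + 1)
    simp only [hs, hTs1]
    rcases le_total (T (k + 1) - ε) 0 with h3 | h3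
    · rw [max_eq_right h3]
      have := le_max_right (T (k + 1 + 1) - ε) 0
      linarith
    · rw [max_eq_left h3]
      have := le_max_left (T (k + 1 + 1) - ε) 0
      linarith
  have hTlim : Tendsto T atTop (𝓝 0) := by
    have := (hp.hasSum.tendsto_sum_nat).const_sub 1
    simpa using this
  have hTslim : Tendsto (fun k => Ts (k + 1)) atTop (𝓝 0) := by
    have h1 := ((hTlim.comp (tendsto_add_atTop_nat 1)).sub_const ε).max
      (tendsto_const_nhds (x := (0 : ℝ)))
    simp only [zero_sub, max_eq_right (neg_nonpos.2 hε.le)] at h1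
    simpa only [hTs1, Function.comp_def] using h1
  have hssum : ∀ k, ∑ i ∈ Finset.range k, s i = 1 - Ts k := fun k => by
    rw [hs, Finset.sum_range_sub', hTs0]
  have hsum : HasSum s 1 := by
    rw [hasSum_iff_tendsto_nat_of_nonneg hs0]
    have h1 := ((tendsto_add_atTop_iff_nat 1).1 hTslim).const_sub 1
    simpa only [hssum, sub_zero] using h1
  -- The partial sums of `s` over `k ≥ 1` terms are `min (∑ p + ε) 1`, and those of `q` obey both
  -- bounds.
  have hsq : shannonEntropy s ≤ shannonEntropy q := by
    refine shannonEntropy_le_of_tail_le hs0 hsum hq ?_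
    rintro (_ | k)
    · simp
    · rw [hssum, hTs1]
      have h1 := (hasSum_tail hq.hasSum (k + 1)).nonneg fun i => hq.nonneg _
      have h2 := h (k + 1)
      have : max (T (k + 1) - ε) 0 ≤ 1 - ∑ i ∈ Finset.range (k + 1), q i :=
        max_le (by simp only [hT]; linarith) h1
      linarith
  -- the mass moved
  set r : ℕ → ℝ := fun n => p (n + 1) - s (n + 1) with hr
  have hr0 : ∀ n, 0 ≤ r n := fun n => sub_nonneg.2 (hsp n)
  have hrp : ∀ n, r n ≤ p (n + 1) := fun n => sub_le_self _ (hs0 _)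
  -- Here `d = min (T 1) ε`: less than ε is moved if `p` has less than ε outside position 0.
  set d : ℝ := T 1 - Ts 1 with hd
  have hrsum : HasSum r d := by
    have h1 := (hasSum_tail hp.hasSum 1).sub (hasSum_tail hsum 1)
    rw [hssum, show 1 - ∑ i ∈ Finset.range 1, p i - (1 - (1 - Ts 1)) = d by
      simp only [hd, hT]; ring] at h1
    exact h1
  have hd0 : 0 ≤ d := hrsum.nonneg hr0
  have hdε : d ≤ ε := by
    have := le_max_left (T 1 - ε) 0
    rw [← hTs1 0] at this
    simp only [hd, zero_add] at this ⊢
    linarith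
  have hs0d : s 0 = p 0 + d := by
    have := hTsucc 0
    have h1 : T 0 = 1 := by simp [hT]
    simp only [hs, hd, hTs0, zero_add] at this ⊢
    linarith
  have hm1 : HasSum (fun n : ℕ => ((n : ℝ) + 1) * p (n + 1)) (∑' n : ℕ, (n : ℝ) * p n) := by
    have := (hasSum_nat_add_iff' 1).2 hm.hasSum
    simpa using this
  have hrm : Summable fun n : ℕ => ((n : ℝ) + 1) * r n :=
    Summable.of_nonneg_of_le (fun n => mul_nonneg (by positivity) (hr0 n))
      (fun n => mul_le_mul_of_nonneg_left (hrp n) (by positivity)) hm1.summable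
  have hrmE : ∑' n : ℕ, ((n : ℝ) + 1) * r n ≤ E := by
    refine le_trans (hasSum_le (fun n => ?_) hrm.hasSum hm1) hmE
    exact mul_le_mul_of_nonneg_left (hrp n) (by positivity)
  have hp1 : ∀ n, p n ≤ 1 := fun n => le_hasSum hp.hasSum n fun i _ => hp.nonneg i
  have hs1 : ∀ n, s n ≤ 1 := fun n => le_hasSum hsum n fun i _ => hs0 i
  have hr1 : ∀ n, r n ≤ 1 := fun n => (hrp n).trans (hp1 _)
  -- Tangent at the geometric weights, of total ε and first moment `E` when index `n` stands for
  -- position `n + 1`. Only the mass and first moment of `r` survive summation.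
  have hterm : ∀ n, negMulLog (r n) ≤ -r n * log (ε ^ 2 / E)
      - log (1 - ε / E) * (((n : ℝ) + 1) * r n - r n)
      + ε ^ 2 / E * (1 - ε / E) ^ n - r n := by
    intro n
    have h1 := negMulLog_le_of_pos (hr0 n)
      (show 0 < ε ^ 2 / E * (1 - ε / E) ^ n by positivity)
    rw [log_mul (by positivity) (by positivity), log_pow] at h1
    linarith
  have hgeom : HasSum (fun n => ε ^ 2 / E * (1 - ε / E) ^ n) ε := by
    have h1 := (hasSum_geometric_of_lt_one hx0.le hx1).mul_left (ε ^ 2 / E)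
    rwa [sub_sub_cancel, show ε ^ 2 / E * (ε / E)⁻¹ = ε by field_simp] at h1
  have hbound := (((hrsum.neg.mul_right (log (ε ^ 2 / E))).sub
    ((hrm.hasSum.sub hrsum).mul_left (log (1 - ε / E)))).add hgeom).sub hrsum
  have hrent : ∑' n, ENNReal.ofReal (negMulLog (r n)) ≤ ENNReal.ofReal (-d * log (ε ^ 2 / E)
      - log (1 - ε / E) * (∑' n : ℕ, ((n : ℝ) + 1) * r n - d) + ε - d) := by
    rw [← hbound.tsum_eq, ENNReal.ofReal_tsum_of_nonneg _ hbound.summable]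
    · exact ENNReal.tsum_le_tsum fun n => ENNReal.ofReal_le_ofReal (hterm n)
    · exact fun n => (negMulLog_nonneg (hr0 n) (hr1 n)).trans (hterm n)
  have hsplit : ∀ u : ℕ → ℝ, shannonEntropy u = ENNReal.ofReal (negMulLog (u 0))
      + ∑' n, ENNReal.ofReal (negMulLog (u (n + 1))) := fun u => by
    rw [shannonEntropy, tsum_eq_zero_add' ENNReal.summable]
  have hgain := gain_le hE hε hε1 hdε hrmE
  -- The tangent is taken at `1 - ε`, so that this term too is affine in `d`.
  have hη : negMulLog (1 - d) ≤ -(1 - d) * log (1 - ε) + (1 - ε) - (1 - d) :=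
    negMulLog_le_of_pos (by linarith) (by linarith)
  have hη0 : 0 ≤ negMulLog (1 - d) := negMulLog_nonneg (by linarith) (by linarith)
  have hR0 : 0 ≤ -d * log (ε ^ 2 / E)
      - log (1 - ε / E) * (∑' n : ℕ, ((n : ℝ) + 1) * r n - d) + ε - d :=
    hbound.nonneg fun n => (negMulLog_nonneg (hr0 n) (hr1 n)).trans (hterm n)
  have hhead : ENNReal.ofReal (negMulLog (p 0))
      ≤ ENNReal.ofReal (negMulLog (s 0)) + ENNReal.ofReal (negMulLog (1 - d)) := by
    rw [← ENNReal.ofReal_add (negMulLog_nonneg (hs0 0) (hs1 0)) hη0]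
    apply ENNReal.ofReal_le_ofReal
    have := hs1 0
    rw [hs0d] at this ⊢
    exact negMulLog_le_add_one_sub (hp.nonneg 0) hd0 this
  have htail : ∑' n, ENNReal.ofReal (negMulLog (p (n + 1)))
      ≤ ∑' n, ENNReal.ofReal (negMulLog (s (n + 1))) + ∑' n, ENNReal.ofReal (negMulLog (r n)) := by
    rw [← ENNReal.tsum_add]
    refine ENNReal.tsum_le_tsum fun n => ?_
    rw [← ENNReal.ofReal_add (negMulLog_nonneg (hs0 _) (hs1 _)) (negMulLog_nonneg (hr0 n) (hr1 n))]
    apply ENNReal.ofReal_le_ofReal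
    have := negMulLog_add_le (hs0 (n + 1)) (hr0 n)
    rwa [show s (n + 1) + r n = p (n + 1) by simp only [hr]; ring] at this
  calc shannonEntropy p
      ≤ (ENNReal.ofReal (negMulLog (s 0)) + ENNReal.ofReal (negMulLog (1 - d)))
        + (∑' n, ENNReal.ofReal (negMulLog (s (n + 1)))
          + ∑' n, ENNReal.ofReal (negMulLog (r n))) := by
        rw [hsplit p]; exact add_le_add hhead htail
    _ = shannonEntropy s + (ENNReal.ofReal (negMulLog (1 - d))
          + ∑' n, ENNReal.ofReal (negMulLog (r n))) := by
        rw [hsplit s]; ring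
    _ ≤ shannonEntropy q + ENNReal.ofReal (binEntropy ε + E * binEntropy (ε / E)) := by
        refine add_le_add hsq ((add_le_add le_rfl hrent).trans ?_)
        rw [← ENNReal.ofReal_add hη0 hR0]
        exact ENNReal.ofReal_le_ofReal (by linarith)

section

variable {H : Type u} [NormedAddCommGroup H] [InnerProductSpace ℂ H]

/-! ### Parseval and Bessel in `[0, ∞]` -/

lemma tsum_ofReal_norm_inner_sq {ι : Type*} (v : HilbertBasis ι ℂ H) (x : H) :
    ∑' i, ENNReal.ofReal (‖⟪v i, x⟫_ℂ‖ ^ 2) = ENNReal.ofReal (‖x‖ ^ 2) := by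
  have h : HasSum (fun i => ‖⟪v i, x⟫_ℂ‖ ^ 2) (‖x‖ ^ 2) := by
    have h1 := Complex.hasSum_re (v.hasSum_inner_mul_inner x x)
    rw [inner_self_eq_norm_sq_to_K] at h1
    convert h1 using 1
    · ext i
      rw [← inner_conj_symm x (v i), Complex.conj_mul']
      norm_cast
    · norm_cast
  rw [← h.tsum_eq, ENNReal.ofReal_tsum_of_nonneg (fun i => by positivity) h.summable]

lemma tsum_ofReal_norm_inner_sq_le {κ : Type*} {e : κ → H} (he : Orthonormal ℂ e) (x : H) :
    ∑' i, ENNReal.ofReal (‖⟪e i, x⟫_ℂ‖ ^ 2) ≤ ENNReal.ofReal (‖x‖ ^ 2) := by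
  rw [← ENNReal.ofReal_tsum_of_nonneg (fun i => by positivity) (he.inner_products_summable x)]
  exact ENNReal.ofReal_le_ofReal (he.tsum_inner_products_le x)

/-! ### Finite rank operators are compact -/

lemma isCompactOperator_rankOne (x y : H) :
    IsCompactOperator (InnerProductSpace.rankOne ℂ x y : H →L[ℂ] H) := by
  rw [InnerProductSpace.rankOne_def']
  exact (isCompactOperator_of_locallyCompactSpace_rng
    (ContinuousLinearMap.toSpanSingleton ℂ x)).comp_clm (innerSL ℂ y)

lemma isCompactOperator_sum {s : Finset ℕ} {A : ℕ → H →L[ℂ] H}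
    (h : ∀ k, IsCompactOperator (A k)) : IsCompactOperator (∑ k ∈ s, A k : H →L[ℂ] H) := by
  induction s using Finset.cons_induction with
  | empty => exact isCompactOperator_zero
  | cons a s ha ih => rw [Finset.sum_cons]; exact (h a).add ih

variable [CompleteSpace H]

/-! ### Traces of positive operators -/

lemma inner_sqrt_comm (T : H →L[ℂ] H) (x y : H) :
    ⟪CFC.sqrt T x, y⟫_ℂ = ⟪x, CFC.sqrt T y⟫_ℂ :=
  ((ContinuousLinearMap.nonneg_iff_isPositive _).1 (CFC.sqrt_nonneg T)).isSymmetric x y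

lemma re_inner_eq_norm_sqrt_sq {T : H →L[ℂ] H} (hT : T.IsPositive) (x : H) :
    (⟪x, T x⟫_ℂ).re = ‖CFC.sqrt T x‖ ^ 2 := by
  have h0 : 0 ≤ T := (ContinuousLinearMap.nonneg_iff_isPositive T).2 hT
  conv_lhs => rw [← CFC.sqrt_mul_sqrt_self T h0]
  rw [mul_apply_eq_comp, ← inner_sqrt_comm, inner_self_eq_norm_sq_to_K]
  norm_cast

/-- Parseval in `v`, symmetry of the root and exchange of sums. The inner sum over `j` is then ready
for Bessel (trace dominates) or Parseval (trace is basis independent). -/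
lemma tsum_ofReal_norm_sqrt_sq_comm {ι κ : Type*} (v : HilbertBasis ι ℂ H) (T : H →L[ℂ] H)
    (e : κ → H) : ∑' j, ENNReal.ofReal (‖CFC.sqrt T (e j)‖ ^ 2)
      = ∑' i, ∑' j, ENNReal.ofReal (‖⟪e j, CFC.sqrt T (v i)⟫_ℂ‖ ^ 2) := by
  rw [ENNReal.tsum_comm]
  refine tsum_congr fun j => ?_
  rw [← tsum_ofReal_norm_inner_sq v]
  refine tsum_congr fun i => ?_
  rw [← inner_sqrt_comm, norm_inner_symm]

lemma tsum_ofReal_inner_le_posTr (b : HilbertBasis ℕ ℂ H) {T : H →L[ℂ] H} (hT : T.IsPositive)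
    {κ : Type*} {e : κ → H} (he : Orthonormal ℂ e) :
    ∑' j, ENNReal.ofReal (⟪e j, T (e j)⟫_ℂ).re ≤ posTr b T := by
  simp only [posTr, re_inner_eq_norm_sqrt_sq hT]
  rw [tsum_ofReal_norm_sqrt_sq_comm b]
  exact ENNReal.tsum_le_tsum fun i => tsum_ofReal_norm_inner_sq_le he _

lemma tsum_ofReal_inner_eq_posTr (b : HilbertBasis ℕ ℂ H) {T : H →L[ℂ] H} (hT : T.IsPositive)
    {κ : Type*} (v : HilbertBasis κ ℂ H) :
    ∑' j, ENNReal.ofReal (⟪v j, T (v j)⟫_ℂ).re = posTr b T := by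
  simp only [posTr, re_inner_eq_norm_sqrt_sq hT]
  rw [tsum_ofReal_norm_sqrt_sq_comm b]
  exact tsum_congr fun i => tsum_ofReal_norm_inner_sq v _

/-! ### Continuous functional calculus on eigenvectors -/

/-- The functions for which this holds form a closed subalgebra containing the identity, so
Stone–Weierstrass gives all continuous ones. -/
lemma cfc_apply_eigenvector {T : H →L[ℂ] H} (hT : IsSelfAdjoint T) {f : ℝ → ℝ}
    (hf : ContinuousOn f (spectrum ℝ T)) {v : H} {m : ℝ} (h : T v = (m : ℂ) • v) :
    cfc f T v = (f m : ℂ) • v := by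
  rcases eq_or_ne v 0 with rfl | hv
  · simp
  have hm : m ∈ spectrum ℝ T := by
    rw [spectrum.mem_iff]
    intro hu
    obtain ⟨S, hS⟩ := hu.exists_left_inv
    apply hv
    have h1 : (S * (algebraMap ℝ (H →L[ℂ] H) m - T)) v = v := by rw [hS]; rfl
    rw [← h1, mul_apply_eq_comp, sub_apply, h,
      Algebra.algebraMap_eq_smul_one]
    simp
  rw [cfc_apply f T hT hf]
  have key : ∀ φ : C(spectrum ℝ T, ℝ), cfcHom hT φ v = ((φ ⟨m, hm⟩ : ℝ) : ℂ) • v := by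
    intro φ
    induction φ using ContinuousMap.induction_on_of_compact with
    | const r =>
      have : (ContinuousMap.const (spectrum ℝ T) r) = algebraMap ℝ _ r := rfl
      rw [this, AlgHomClass.commutes, Algebra.algebraMap_eq_smul_one]
      simp
    | id => rw [cfcHom_id hT, h]; rfl
    | star_id => rw [map_star, cfcHom_id hT, hT.star_eq, h]; rfl
    | add f g hf hg => rw [map_add, add_apply, hf, hg]; simp [add_smul]
    | mul f g hf hg =>
      rw [map_mul, mul_apply_eq_comp, hg, map_smul, hf]
      rw [smul_smul, ContinuousMap.mul_apply, Complex.ofReal_mul, mul_comm]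
    | frequently f hf =>
      have hc : IsClosed {g : C(spectrum ℝ T, ℝ) | cfcHom hT g v = ((g ⟨m, hm⟩ : ℝ) : ℂ) • v} := by
        refine isClosed_eq ?_ ?_
        · exact (ContinuousLinearMap.apply ℂ H v).continuous.comp (cfcHom_continuous hT)
        · exact (Complex.continuous_ofReal.comp (continuous_eval_const _)).smul
            continuous_const
      exact hc.mem_of_frequently_of_tendsto hf tendsto_id
  rw [key]
  rfl

/-! ### Positive operators of finite trace are compact -/

/-- The root `S` is Hilbert–Schmidt: its truncations to the first `n` output coordinates have
squared norm error at most `∑_{k≥n} ‖S (b k)‖²`. So `S` is a limit of finite rank operators, and `T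
= S * S`. -/
lemma isCompactOperator_of_posTr_ne_top (b : HilbertBasis ℕ ℂ H) {T : H →L[ℂ] H}
    (hT : T.IsPositive) (h : posTr b T ≠ ∞) : IsCompactOperator T := by
  set S := CFC.sqrt T with hS
  have h0 : 0 ≤ T := (ContinuousLinearMap.nonneg_iff_isPositive T).2 hT
  set A : ℕ → H →L[ℂ] H := fun n =>
    ∑ k ∈ Finset.range n, InnerProductSpace.rankOne ℂ (b k) (S (b k)) with hA
  set t : ℕ → ℝ≥0∞ := fun n => ∑' k, ENNReal.ofReal (‖S (b (k + n))‖ ^ 2) with ht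
  have hsum : ∑' k, ENNReal.ofReal (‖S (b k)‖ ^ 2) ≠ ∞ := by
    simpa only [posTr, re_inner_eq_norm_sqrt_sq hT] using h
  have htlim : Tendsto t atTop (𝓝 0) := ENNReal.tendsto_sum_nat_add _ hsum
  have ht_top : ∀ n, t n ≠ ∞ := fun n =>
    ne_top_of_le_ne_top hsum (ENNReal.tsum_comp_le_tsum_of_injective (add_left_injective n)
      (fun k => ENNReal.ofReal (‖S (b k)‖ ^ 2)))
  have hcoef : ∀ n x k, ⟪b k, (A n - S) x⟫_ℂ = if k < n then 0 else -⟪S (b k), x⟫_ℂ := by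
    intro n x k
    have h1 : A n x = ∑ j ∈ Finset.range n, ⟪S (b j), x⟫_ℂ • b j := by
      simp [hA]
    rw [sub_apply, inner_sub_right, h1, inner_sum]
    simp only [inner_smul_right, orthonormal_iff_ite.1 b.orthonormal, mul_ite, mul_one, mul_zero,
      Finset.sum_ite_eq, Finset.mem_range, hS, inner_sqrt_comm]
    split_ifs <;> simp
  have hbound : ∀ n, ‖A n - S‖ ≤ √(t n).toReal := by
    intro n
    refine ContinuousLinearMap.opNorm_le_bound _ (Real.sqrt_nonneg _) fun x => ?_
    apply le_of_sq_le_sq _ (by positivity)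
    rw [mul_pow, Real.sq_sqrt ENNReal.toReal_nonneg]
    rw [← ENNReal.ofReal_le_ofReal_iff (by positivity), ENNReal.ofReal_mul ENNReal.toReal_nonneg,
      ENNReal.ofReal_toReal (ht_top n), ← tsum_ofReal_norm_inner_sq b,
      ← ENNReal.summable.sum_add_tsum_nat_add' (k := n), Finset.sum_eq_zero, zero_add,
      ht, ← ENNReal.tsum_mul_right]
    · refine ENNReal.tsum_le_tsum fun k => ?_
      rw [hcoef, if_neg (by omega), norm_neg, ← ENNReal.ofReal_mul (by positivity), ← mul_pow]
      apply ENNReal.ofReal_le_ofReal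
      gcongr
      exact norm_inner_le_norm _ _
    · intro k hk
      rw [hcoef, if_pos (by simpa using hk)]
      simp
  have hlim : Tendsto A atTop (𝓝 S) := by
    rw [tendsto_iff_norm_sub_tendsto_zero]
    refine squeeze_zero (fun n => norm_nonneg _) hbound ?_
    have h1 := (Real.continuous_sqrt.tendsto _).comp
      ((ENNReal.tendsto_toReal ENNReal.zero_ne_top).comp htlim)
    simpa [Function.comp_def] using h1
  have hSc : IsCompactOperator S := isCompactOperator_of_tendsto hlim
    (Eventually.of_forall fun n => isCompactOperator_sum fun k => isCompactOperator_rankOne _ _)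
  rw [← CFC.sqrt_mul_sqrt_self T h0]
  exact hSc.comp_clm S

/-! ### Diagonalization -/

/-- Hilbert bases of all eigenspaces are glued; the spectral theorem for compact symmetric operators
makes their span dense. Positivity makes every eigenvalue that occurs real and nonnegative. -/
lemma exists_eigenbasis {T : H →L[ℂ] H} (hc : IsCompactOperator T) (hT : T.IsPositive) :
    ∃ (ι : Type u) (v : HilbertBasis ι ℂ H) (m : ι → ℝ), (∀ i, 0 ≤ m i) ∧
      ∀ i, T (v i) = (m i : ℂ) • v i := by
  have hsymm : (T : H →ₗ[ℂ] H).IsSymmetric := hT.isSymmetric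
  let G : ℂ → Submodule ℂ H := fun μ => Module.End.eigenspace (T : H →ₗ[ℂ] H) μ
  have hGc : ∀ μ, CompleteSpace (G μ) := fun μ => by
    have : IsClosed ((G μ : Submodule ℂ H) : Set H) := by
      have h1 : ((G μ : Submodule ℂ H) : Set H) = {x | T x = μ • x} := by
        ext x; exact Module.End.mem_eigenspace_iff
      rw [h1]
      exact isClosed_eq T.continuous (continuous_const_smul μ)
    exact this.completeSpace_coe
  choose w B hB using fun μ => exists_hilbertBasis ℂ (G μ)
  let v : (Σ μ : ℂ, w μ) → H := fun i => (B i.1 i.2 : G i.1)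
  have hv : Orthonormal ℂ v :=
    hsymm.orthogonalFamily_eigenspaces.orthonormal_sigma_orthonormal fun μ => (B μ).orthonormal
  have hbot : (Submodule.span ℂ (Set.range v))ᗮ = ⊥ := by
    rw [eq_bot_iff, ← ContinuousLinearMap.orthogonalComplement_iSup_eigenspaces_eq_bot hc hsymm,
      ← Submodule.iInf_orthogonal]
    intro x hx
    rw [Submodule.mem_iInf]
    intro μ y hy
    have h1 : ∀ i, ⟪B μ i, (G μ).orthogonalProjectionOnto x⟫_ℂ = 0 := by
      intro i
      rw [Submodule.inner_orthogonalProjectionOnto_eq_of_mem_left]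
      exact hx _ (Submodule.subset_span ⟨⟨μ, i⟩, rfl⟩)
    have h2 : (G μ).orthogonalProjectionOnto x = 0 := by
      apply (B μ).repr.injective
      ext i
      rw [(B μ).repr_apply_apply, h1]
      simp
    have := Submodule.inner_orthogonalProjectionOnto_eq_of_mem_left (⟨y, hy⟩ : G μ) x
    rw [h2, inner_zero_right] at this
    exact this.symm
  have heig : ∀ i, T (v i) = i.1 • v i := fun i =>
    Module.End.mem_eigenspace_iff.1 (B i.1 i.2).2
  have hre : ∀ i : Σ μ : ℂ, w μ, 0 ≤ i.1.re ∧ 0 = i.1.im := fun i => by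
    have h1 := hT.inner_nonneg_right (v i)
    rw [heig, inner_smul_right, inner_self_eq_norm_sq_to_K, hv.1 i] at h1
    exact Complex.nonneg_iff.1 (by simpa using h1)
  refine ⟨_, HilbertBasis.mkOfOrthogonalEqBot hv hbot, fun i => i.1.re,
    fun i => (hre i).1, fun i => ?_⟩
  rw [HilbertBasis.coe_mkOfOrthogonalEqBot, heig]
  congr 1
  exact Complex.ext rfl (hre i).2.symm

/-- The terms of a nonnegative summable family over an infinite type can be enumerated in decreasing
order, up to terms that vanish. -/
lemma exists_antitone_enumeration {ι : Type*} [Infinite ι] {m : ι → ℝ} (h0 : ∀ i, 0 ≤ m i)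
    (hs : Summable m) :
    ∃ e : ℕ → ι, Function.Injective e ∧ Antitone (m ∘ e) ∧ ∀ i ∉ Set.range e, m i = 0 := by
  classical
  -- Greedy choice: summability leaves finitely many values above a positive one; if none is
  -- positive outside `F`, any index will do.
  have hmax : ∀ F : Finset ι, ∃ i ∉ F, ∀ j ∉ F, m j ≤ m i := by
    intro F
    by_cases hF : ∃ j ∉ F, 0 < m j
    · obtain ⟨j₀, hj₀, hpos⟩ := hF
      have hfin : {j | m j₀ ≤ m j}.Finite := by
        have := hs.tendsto_cofinite_zero.eventually (gt_mem_nhds hpos)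
        simpa [eventually_cofinite] using this
      have hj₀' : j₀ ∈ hfin.toFinset \ F := by simp [hj₀]
      obtain ⟨i, hi, hi2⟩ := Finset.exists_max_image _ m ⟨j₀, hj₀'⟩
      rw [Finset.mem_sdiff] at hi
      refine ⟨i, hi.2, fun j hj => ?_⟩
      rcases le_total (m j₀) (m j) with h | h
      · exact hi2 j (by simp [hj, h])
      · exact h.trans (hi2 j₀ hj₀')
    · push Not at hF
      obtain ⟨i, hi⟩ := Infinite.exists_notMem_finset F
      exact ⟨i, hi, fun j hj => (hF j hj).trans (h0 i)⟩
  choose g hg hg2 using hmax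
  let F : ℕ → Finset ι := fun n => Nat.rec ∅ (fun _ F => insert (g F) F) n
  have hFs : ∀ n, F (n + 1) = insert (g (F n)) (F n) := fun n => rfl
  have hFm : Monotone F := monotone_nat_of_le_succ fun n => by
    rw [hFs]; exact Finset.subset_insert _ _
  have hmem : ∀ n, g (F n) ∈ F (n + 1) := fun n => by
    rw [hFs]; exact Finset.mem_insert_self _ _
  have hinj : Function.Injective fun n => g (F n) := by
    have hlt : ∀ a c, a < c → g (F a) ≠ g (F c) := fun a c hac h =>
      hg (F c) (h ▸ hFm (Nat.succ_le_of_lt hac) (hmem a))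
    intro a c hac
    rcases lt_trichotomy a c with h | h | h
    · exact absurd hac (hlt a c h)
    · exact h
    · exact absurd hac.symm (hlt c a h)
  have hrange : ∀ n, ∀ i ∈ F n, i ∈ Set.range fun n => g (F n) := by
    intro n
    induction n with
    | zero => intro i hi; exact absurd hi (Finset.notMem_empty i)
    | succ n ih =>
      intro i hi
      rw [hFs, Finset.mem_insert] at hi
      rcases hi with rfl | hi
      · exact ⟨n, rfl⟩
      · exact ih i hi
  refine ⟨fun n => g (F n), hinj, antitone_nat_of_succ_le fun n => ?_, fun i hi => ?_⟩
  · exact hg2 (F n) _ fun h => hg (F (n + 1)) (hFm (Nat.le_succ n) h)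
  -- A value never chosen lies below all chosen ones, which tend to 0.
  · refine le_antisymm ?_ (h0 i)
    exact ge_of_tendsto' (hs.comp_injective hinj).tendsto_atTop_zero
      fun n => hg2 (F n) i fun h => hi (hrange n i h)

end

section

variable {H : Type u} [NormedAddCommGroup H] [InnerProductSpace ℂ H]

lemma infinite_of_hilbertBasis (b : HilbertBasis ℕ ℂ H) {ι : Type*} (v : HilbertBasis ι ℂ H) :
    Infinite ι := by
  by_contra hι
  have := not_infinite_iff_finite.1 hι
  have := Fintype.ofFinite ι
  have : FiniteDimensional ℂ H := v.toOrthonormalBasis.toBasis.finiteDimensional_of_finite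
  have h := b.orthonormal.linearIndependent.finite
  exact not_finite ℕ

/-! ### States -/

lemma IsState.re_inner_nonneg {b : HilbertBasis ℕ ℂ H} {ρ : H →L[ℂ] H} (hρ : IsState b ρ) (x : H) :
    0 ≤ (⟪x, ρ x⟫_ℂ).re := hρ.pos.re_inner_nonneg_right x

/-- A decreasing enumeration `p` of the eigenvalues of `ρ`, with eigenvectors `f`. -/
structure IsSortedSpectrum (ρ : H →L[ℂ] H) (p : ℕ → ℝ) (f : ℕ → H) : Prop where
  sorted : IsSortedDistribution p
  orthonormal : Orthonormal ℂ f
  apply_eq : ∀ n, ρ (f n) = (p n : ℂ) • f n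
  hasSum_inner : ∀ x, HasSum (fun n => p n * ‖⟪f n, x⟫_ℂ‖ ^ 2) (⟪x, ρ x⟫_ℂ).re

/-- Ky Fan's maximum principle. -/
lemma IsSortedSpectrum.sum_re_inner_le {ρ : H →L[ℂ] H} {p : ℕ → ℝ} {f : ℕ → H}
    (h : IsSortedSpectrum ρ p f) {g : ℕ → H} (hg : Orthonormal ℂ g) (k : ℕ) :
    ∑ i ∈ Finset.range k, (⟪g i, ρ (g i)⟫_ℂ).re ≤ ∑ n ∈ Finset.range k, p n := by
  -- By Bessel in either family, `0 ≤ w n ≤ 1` and `∑ w ≤ k`; under these constraints `∑ p n * w n`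
  -- is largest when `w` sits on the `k` largest eigenvalues.
  set w : ℕ → ℝ := fun n => ∑ i ∈ Finset.range k, ‖⟪f n, g i⟫_ℂ‖ ^ 2 with hw
  have hw0 : ∀ n, 0 ≤ w n := fun n => Finset.sum_nonneg fun i _ => by positivity
  have hw1 : ∀ n, w n ≤ 1 := fun n => by
    have := hg.sum_inner_products_le (f n) (s := Finset.range k)
    rw [h.orthonormal.1 n, one_pow] at this
    simpa only [hw, norm_inner_symm] using this
  have hsum : HasSum (fun n => p n * w n) (∑ i ∈ Finset.range k, (⟪g i, ρ (g i)⟫_ℂ).re) := by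
    simp only [hw, Finset.mul_sum]
    exact hasSum_sum fun i _ => h.hasSum_inner (g i)
  have hwk : ∀ s : Finset ℕ, ∑ n ∈ s, w n ≤ k := fun s => by
    rw [hw, Finset.sum_comm]
    calc ∑ i ∈ Finset.range k, ∑ n ∈ s, ‖⟪f n, g i⟫_ℂ‖ ^ 2
        ≤ ∑ i ∈ Finset.range k, (1 : ℝ) := Finset.sum_le_sum fun i _ => by
          have := h.orthonormal.sum_inner_products_le (g i) (s := s)
          rwa [hg.1 i, one_pow] at this
      _ = k := by simp
  refine hasSum_le_of_sum_le hsum fun s => ?_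
  have h1 : ∑ n ∈ s, p n * w n ≤ ∑ n ∈ s ∪ Finset.range k, p n * w n :=
    Finset.sum_le_sum_of_subset_of_nonneg Finset.subset_union_left
      fun n _ _ => mul_nonneg (h.sorted.nonneg n) (hw0 n)
  refine h1.trans ?_
  set t := s ∪ Finset.range k
  -- compare with the threshold value `p k`
  have h2 : ∑ n ∈ t, (p n - p k) * w n ≤ ∑ n ∈ Finset.range k, (p n - p k) := by
    rw [← Finset.sum_sdiff (Finset.subset_union_right : Finset.range k ⊆ t)]
    have h3 : ∑ n ∈ t \ Finset.range k, (p n - p k) * w n ≤ 0 :=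
      Finset.sum_nonpos fun n hn => by
        have hn' : k ≤ n := by simpa using (Finset.mem_sdiff.1 hn).2
        exact mul_nonpos_of_nonpos_of_nonneg (sub_nonpos.2 (h.sorted.antitone hn')) (hw0 n)
    have h4 : ∑ n ∈ Finset.range k, (p n - p k) * w n ≤ ∑ n ∈ Finset.range k, (p n - p k) :=
      Finset.sum_le_sum fun n hn => by
        have hn' : n ≤ k := (Finset.mem_range.1 hn).le
        exact mul_le_of_le_one_right (sub_nonneg.2 (h.sorted.antitone hn')) (hw1 n)
    linarith
  simp only [sub_mul, Finset.sum_sub_distrib, Finset.sum_const, Finset.card_range, nsmul_eq_mul,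
    ← Finset.mul_sum] at h2
  have := mul_le_mul_of_nonneg_left (hwk t) (h.sorted.nonneg k)
  linarith

lemma IsSortedSpectrum.re_inner_eq {ρ : H →L[ℂ] H} {p : ℕ → ℝ} {f : ℕ → H}
    (h : IsSortedSpectrum ρ p f) (n : ℕ) : (⟪f n, ρ (f n)⟫_ℂ).re = p n := by
  rw [h.apply_eq, inner_smul_right, inner_self_eq_norm_sq_to_K, h.orthonormal.1 n]
  simp

variable [CompleteSpace H]

lemma IsState.hasSum_re_inner {b : HilbertBasis ℕ ℂ H} {ρ : H →L[ℂ] H} (hρ : IsState b ρ)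
    {ι : Type*} (v : HilbertBasis ι ℂ H) : HasSum (fun i => (⟪v i, ρ (v i)⟫_ℂ).re) 1 := by
  have h := (tsum_ofReal_inner_eq_posTr b hρ.pos v).trans hρ.trace_eq_one
  have h2 := ENNReal.hasSum_toReal (f := fun i => ENNReal.ofReal (⟪v i, ρ (v i)⟫_ℂ).re)
    (by rw [h]; exact ENNReal.one_ne_top)
  rw [← ENNReal.tsum_toReal_eq (fun _ => ENNReal.ofReal_ne_top), h] at h2
  simpa only [ENNReal.toReal_ofReal (hρ.re_inner_nonneg _), ENNReal.toReal_one] using h2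

lemma IsState.le_one {b : HilbertBasis ℕ ℂ H} {ρ : H →L[ℂ] H} (hρ : IsState b ρ) : ρ ≤ 1 := by
  rw [ContinuousLinearMap.le_def]
  refine ⟨(ContinuousLinearMap.isPositive_one.isSymmetric).sub hρ.pos.isSymmetric, fun x => ?_⟩
  rw [ContinuousLinearMap.reApplyInnerSelf_apply, ← inner_re_symm, sub_apply, inner_sub_right,
    map_sub, sub_nonneg]
  rcases eq_or_ne x 0 with rfl | hx
  · simp
  have hx0 : (0 : ℝ) < ‖x‖ := norm_pos_iff.2 hx
  have he : Orthonormal ℂ fun _ : Unit => ((‖x‖⁻¹ : ℝ) : ℂ) • x :=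
    ⟨fun _ => by rw [norm_smul]; simp [hx], fun i j hij => absurd (Subsingleton.elim i j) hij⟩
  have h := tsum_ofReal_inner_le_posTr b hρ.pos he
  rw [hρ.trace_eq_one, tsum_fintype, Finset.univ_unique, Finset.sum_singleton,
    ENNReal.ofReal_le_one, map_smul, inner_smul_left, inner_smul_right, Complex.conj_ofReal,
    Complex.re_ofReal_mul, Complex.re_ofReal_mul, ← mul_assoc, ← mul_inv,
    inv_mul_le_one₀ (by positivity)] at h
  rw [one_apply_eq_self, inner_self_eq_norm_mul_norm]
  exact h

/-- The spectrum lies in `[0, 1]`, where `negMulLog` is nonnegative. Positivity lets the entropy's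
trace be computed in an eigenbasis. -/
lemma IsState.isPositive_cfc_negMulLog {b : HilbertBasis ℕ ℂ H} {ρ : H →L[ℂ] H}
    (hρ : IsState b ρ) : (cfc negMulLog ρ).IsPositive := by
  have h0 : 0 ≤ ρ := (ContinuousLinearMap.nonneg_iff_isPositive ρ).2 hρ.pos
  rw [← ContinuousLinearMap.nonneg_iff_isPositive]
  refine cfc_nonneg fun x hx => negMulLog_nonneg (spectrum_nonneg_of_nonneg h0 hx) ?_
  exact (CFC.le_one_iff (R := ℝ) ρ).1 hρ.le_one x hx

lemma IsState.exists_isSortedSpectrum {b : HilbertBasis ℕ ℂ H} {ρ : H →L[ℂ] H}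
    (hρ : IsState b ρ) :
    ∃ p f, IsSortedSpectrum ρ p f ∧ vonNeumannEntropy b ρ = shannonEntropy p := by
  have hc := isCompactOperator_of_posTr_ne_top b hρ.pos
    (by rw [hρ.trace_eq_one]; exact ENNReal.one_ne_top)
  obtain ⟨ι, v, m, hm0, hm⟩ := exists_eigenbasis hc hρ.pos
  have : Infinite ι := infinite_of_hilbertBasis b v
  have hinner : ∀ (T : H →L[ℂ] H) (i : ι) (c : ℝ), T (v i) = (c : ℂ) • v i →
      (⟪v i, T (v i)⟫_ℂ).re = c := by
    intro T i c h
    rw [h, inner_smul_right, inner_self_eq_norm_sq_to_K, v.orthonormal.1 i]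
    simp
  have hsum : HasSum m 1 := by simpa only [hinner ρ _ _ (hm _)] using hρ.hasSum_re_inner v
  obtain ⟨e, he, hanti, hrange⟩ := exists_antitone_enumeration hm0 hsum.summable
  -- The listed eigenvectors may miss part of the kernel, but omitted ones have eigenvalue 0 and
  -- contribute to no sum.
  refine ⟨m ∘ e, v ∘ e, ⟨⟨fun n => hm0 _, hanti, (he.hasSum_iff hrange).2 hsum⟩,
    v.orthonormal.comp e he, fun n => hm _, fun x => ?_⟩, ?_⟩
  · refine (he.hasSum_iff (f := fun i => m i * ‖⟪v i, x⟫_ℂ‖ ^ 2)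
      (fun i hi => by rw [hrange i hi, zero_mul])).2 ?_
    have h1 := Complex.hasSum_re (v.hasSum_inner_mul_inner x (ρ x))
    have h2 : ∀ i, (⟪x, v i⟫_ℂ * ⟪v i, ρ x⟫_ℂ).re = m i * ‖⟪v i, x⟫_ℂ‖ ^ 2 := fun i => by
      have h3 : ⟪ρ (v i), x⟫_ℂ = ⟪v i, ρ x⟫_ℂ := hρ.pos.isSymmetric (v i) x
      rw [← h3, hm, inner_smul_left, Complex.conj_ofReal, mul_left_comm, Complex.re_ofReal_mul,
        ← inner_conj_symm x (v i), Complex.conj_mul']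
      norm_cast
    simpa only [h2] using h1
  · have hcfc : ∀ i, cfc negMulLog ρ (v i) = (negMulLog (m i) : ℂ) • v i := fun i =>
      cfc_apply_eigenvector hρ.pos.isSelfAdjoint continuous_negMulLog.continuousOn (hm i)
    rw [vonNeumannEntropy, ← tsum_ofReal_inner_eq_posTr b hρ.isPositive_cfc_negMulLog v]
    simp only [hinner _ _ _ (hcfc _)]
    refine (he.tsum_eq fun i hi => ?_).symm
    by_contra h
    exact hi (by simp [hrange i h])

/-! ### Energy -/

/-- The self-adjoint spectral projection moves onto `b k`, which it fixes for `k ≤ n` and kills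
otherwise. -/
lemma tr_numberOpTrunc_comp (b : HilbertBasis ℕ ℂ H) (ρ : H →L[ℂ] H) (n : ℕ) :
    tr b (numberOpTrunc b n ∘ₗ (ρ : H →ₗ[ℂ] H))
      = ∑ k ∈ Finset.range (n + 1), (k : ℂ) * ⟪b k, ρ (b k)⟫_ℂ := by
  have key : ∀ k, ⟪b k, (numberOpTrunc b n ∘ₗ (ρ : H →ₗ[ℂ] H)) (b k)⟫_ℂ
      = if k < n + 1 then (k : ℂ) * ⟪b k, ρ (b k)⟫_ℂ else 0 := by
    intro k
    refine (inner_numberOp b _ k).trans ?_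
    show (k : ℂ) * ⟪b k, (spectralSubspace (numberOp b) n).starProjection (ρ (b k))⟫_ℂ = _
    rw [← Submodule.inner_starProjection_left_eq_right]
    split_ifs with hk
    · rw [Submodule.starProjection_eq_self_iff.2]
      rw [spectralSubspace_numberOp]
      exact Submodule.subset_span ⟨k, Nat.lt_succ_iff.1 hk, rfl⟩
    · rw [(Submodule.starProjection_apply_eq_zero_iff _).2, inner_zero_left, mul_zero]
      rw [spectralSubspace_numberOp, Submodule.mem_orthogonal]
      intro x hx
      induction hx using Submodule.span_induction with
      | mem x hx =>
        obtain ⟨j, hj, rfl⟩ := hx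
        have : j ≤ n := hj
        exact b.orthonormal.inner_eq_zero (by omega)
      | zero => simp
      | add x y _ _ hx hy => rw [inner_add_left, hx, hy, add_zero]
      | smul c x _ hx => rw [inner_smul_left, hx, mul_zero]
  rw [tr, tsum_congr key, tsum_eq_sum (s := Finset.range (n + 1)) fun k hk =>
    if_neg (by simpa using hk)]
  exact Finset.sum_congr rfl fun k hk => if_pos (Finset.mem_range.1 hk)

lemma energy_eq_tsum (b : HilbertBasis ℕ ℂ H) {ρ : H →L[ℂ] H} (hρ : ρ.IsPositive) :
    energy b ρ = ∑' n : ℕ, (n : ℝ≥0∞) * ENNReal.ofReal (⟪b n, ρ (b n)⟫_ℂ).re := by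
  have h0 : ∀ x, 0 ≤ (⟪x, ρ x⟫_ℂ).re := fun x => hρ.re_inner_nonneg_right x
  rw [ENNReal.tsum_eq_iSup_nat' (tendsto_add_atTop_nat 1)]
  refine iSup_congr fun n => ?_
  rw [tr_numberOpTrunc_comp, Complex.re_sum,
    ENNReal.ofReal_sum_of_nonneg fun k _ => ?_]
  · refine Finset.sum_congr rfl fun k _ => ?_
    rw [← Complex.ofReal_natCast, Complex.re_ofReal_mul, ENNReal.ofReal_mul (by positivity),
      ENNReal.ofReal_natCast]
  · rw [← Complex.ofReal_natCast, Complex.re_ofReal_mul]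
    exact mul_nonneg (by positivity) (h0 _)

/-- The sorted spectrum minimizes the energy. -/
lemma IsSortedSpectrum.tsum_le_energy {b : HilbertBasis ℕ ℂ H} {ρ : H →L[ℂ] H}
    (hρ : IsState b ρ) {p : ℕ → ℝ} {f : ℕ → H} (h : IsSortedSpectrum ρ p f) :
    ∑' n : ℕ, (n : ℝ≥0∞) * ENNReal.ofReal (p n) ≤ energy b ρ := by
  rw [energy_eq_tsum b hρ.pos]
  -- Ky Fan in the Fock basis: the tails of the spectrum are dominated by those of the diagonal.
  refine tsum_mul_le_of_tail_le Nat.mono_cast fun k => ?_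
  rw [tsum_ofReal_tail h.sorted.nonneg h.sorted.hasSum,
    tsum_ofReal_tail (fun n => hρ.re_inner_nonneg _) (hρ.hasSum_re_inner b)]
  exact ENNReal.ofReal_le_ofReal (by linarith [h.sum_re_inner_le b.orthonormal k])

lemma IsSortedSpectrum.summable_and_tsum_le {b : HilbertBasis ℕ ℂ H} {ρ : H →L[ℂ] H}
    (hρ : IsState b ρ) {p : ℕ → ℝ} {f : ℕ → H} (h : IsSortedSpectrum ρ p f) {E : ℝ} (hE0 : 0 ≤ E)
    (hE : energy b ρ ≤ ENNReal.ofReal E) :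
    (Summable fun n : ℕ => (n : ℝ) * p n) ∧ ∑' n : ℕ, (n : ℝ) * p n ≤ E := by
  have h1 := (h.tsum_le_energy hρ).trans hE
  have h2 : ∀ n : ℕ, (n : ℝ≥0∞) * ENNReal.ofReal (p n) = ENNReal.ofReal (n * p n) := fun n => by
    rw [ENNReal.ofReal_mul (by positivity), ENNReal.ofReal_natCast]
  have h3 : ∀ n : ℕ, 0 ≤ (n : ℝ) * p n := fun n => mul_nonneg (by positivity) (h.sorted.nonneg n)
  simp only [h2] at h1
  have hs : Summable fun n : ℕ => (n : ℝ) * p n :=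
    summable_of_sum_range_le h3 (c := E) fun n => by
      have := (ENNReal.sum_le_tsum (Finset.range n)).trans h1
      rwa [← ENNReal.ofReal_sum_of_nonneg fun k _ => h3 k, ENNReal.ofReal_le_ofReal_iff hE0] at this
  rw [← ENNReal.ofReal_tsum_of_nonneg h3 hs, ENNReal.ofReal_le_ofReal_iff hE0] at h1
  exact ⟨hs, h1⟩

/-! ### Trace norm -/

/-- For states, `∑ ⟨gᵢ, σ gᵢ⟩ - ∑ ⟨gᵢ, ρ gᵢ⟩` is at most half the trace norm of `ρ - σ`. -/
lemma sum_re_inner_le_add {b : HilbertBasis ℕ ℂ H} {ρ σ : H →L[ℂ] H} (hρ : IsState b ρ)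
    (hσ : IsState b σ) {ε : ℝ} (hε : 0 ≤ ε) (h : traceNorm b (ρ - σ) / 2 ≤ ENNReal.ofReal ε)
    {g : ℕ → H} (hg : Orthonormal ℂ g) (k : ℕ) :
    ∑ i ∈ Finset.range k, (⟪g i, σ (g i)⟫_ℂ).re
      ≤ ∑ i ∈ Finset.range k, (⟪g i, ρ (g i)⟫_ℂ).re + ε := by
  set T := ρ - σ with hT
  have hsa : IsSelfAdjoint T := hρ.pos.isSelfAdjoint.sub hσ.pos.isSelfAdjoint
  have hA : (CFC.abs T).IsPositive :=
    (ContinuousLinearMap.nonneg_iff_isPositive _).1 (CFC.abs_nonneg T)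
  -- This is twice the negative part of `T`; its trace is that of `|T|`, because `tr T = 0`.
  have hB : (CFC.abs T - T).IsPositive := by
    rw [← ContinuousLinearMap.nonneg_iff_isPositive, CFC.abs_sub_self T hsa]
    exact nsmul_nonneg (CFC.negPart_nonneg T) 2
  have hC : (CFC.abs T + T).IsPositive := by
    rw [← ContinuousLinearMap.nonneg_iff_isPositive, CFC.abs_add_self T hsa]
    exact nsmul_nonneg (CFC.posPart_nonneg T) 2
  have hTr : ∀ x, (⟪x, T x⟫_ℂ).re = (⟪x, ρ x⟫_ℂ).re - (⟪x, σ x⟫_ℂ).re := fun x => by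
    rw [hT, sub_apply, inner_sub_right, Complex.sub_re]
  have hBr : ∀ x, (⟪x, (CFC.abs T - T) x⟫_ℂ).re = (⟪x, CFC.abs T x⟫_ℂ).re - (⟪x, T x⟫_ℂ).re :=
    fun x => by rw [sub_apply, inner_sub_right, Complex.sub_re]
  have hCr : ∀ x, (⟪x, (CFC.abs T + T) x⟫_ℂ).re = (⟪x, CFC.abs T x⟫_ℂ).re + (⟪x, T x⟫_ℂ).re :=
    fun x => by rw [add_apply, inner_add_right, Complex.add_re]
  have hA0 : ∀ x, 0 ≤ (⟪x, CFC.abs T x⟫_ℂ).re := fun x => hA.re_inner_nonneg_right x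
  have hB0 : ∀ x, 0 ≤ (⟪x, (CFC.abs T - T) x⟫_ℂ).re := fun x => hB.re_inner_nonneg_right x
  have hC0 : ∀ x, 0 ≤ (⟪x, (CFC.abs T + T) x⟫_ℂ).re := fun x => hC.re_inner_nonneg_right x
  have hle : posTr b (CFC.abs T) ≤ ENNReal.ofReal (2 * ε) := by
    rw [ENNReal.div_le_iff two_ne_zero ENNReal.ofNat_ne_top] at h
    rwa [mul_comm 2, ENNReal.ofReal_mul hε, ENNReal.ofReal_ofNat]
  have hTsum : HasSum (fun n => (⟪b n, T (b n)⟫_ℂ).re) 0 := by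
    simpa only [hTr, sub_self] using (hρ.hasSum_re_inner b).sub (hσ.hasSum_re_inner b)
  have hAsum : Summable fun n => (⟪b n, CFC.abs T (b n)⟫_ℂ).re := by
    have h1 := ENNReal.summable_toReal (ne_top_of_le_ne_top ENNReal.ofReal_ne_top hle)
    simpa only [ENNReal.toReal_ofReal (hA0 _)] using h1
  have hAle : ∑' n, (⟪b n, CFC.abs T (b n)⟫_ℂ).re ≤ 2 * ε := by
    rwa [posTr, ← ENNReal.ofReal_tsum_of_nonneg (fun n => hA0 _) hAsum,
      ENNReal.ofReal_le_ofReal_iff (by positivity)] at hle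
  have hBle : posTr b (CFC.abs T - T) ≤ ENNReal.ofReal (2 * ε) := by
    have h1 := hAsum.hasSum.sub hTsum
    simp only [← hBr, sub_zero] at h1
    rw [posTr, ← ENNReal.ofReal_tsum_of_nonneg (fun n => hB0 _) h1.summable, h1.tsum_eq]
    exact ENNReal.ofReal_le_ofReal hAle
  have h2 := ((ENNReal.sum_le_tsum (Finset.range k)).trans
    (tsum_ofReal_inner_le_posTr b hB hg)).trans hBle
  rw [← ENNReal.ofReal_sum_of_nonneg fun i _ => hB0 _,
    ENNReal.ofReal_le_ofReal_iff (by positivity)] at h2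
  -- From `|T| + T ≥ 0` follows `2 (σ - ρ) = -2T ≤ |T| - T`.
  have h3 : 2 * (∑ i ∈ Finset.range k, (⟪g i, σ (g i)⟫_ℂ).re
      - ∑ i ∈ Finset.range k, (⟪g i, ρ (g i)⟫_ℂ).re)
      ≤ ∑ i ∈ Finset.range k, (⟪g i, (CFC.abs T - T) (g i)⟫_ℂ).re := by
    rw [← Finset.sum_sub_distrib, Finset.mul_sum]
    refine Finset.sum_le_sum fun i _ => ?_
    have h4 := hC0 (g i)
    rw [hCr] at h4
    rw [hBr]
    rw [hTr] at h4 ⊢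
    linarith
  linarith

lemma traceNorm_sub_comm (b : HilbertBasis ℕ ℂ H) (ρ σ : H →L[ℂ] H) :
    traceNorm b (ρ - σ) = traceNorm b (σ - ρ) := by
  rw [traceNorm, traceNorm, ← CFC.abs_neg, neg_sub]

/-- The one-sided entropy continuity bound, under an energy constraint on the first state. -/
theorem vonNeumannEntropy_le_add {b : HilbertBasis ℕ ℂ H} {E ε : ℝ} (hE : 0 < E) (hε₀ : 0 ≤ ε)
    (hε₁ : ε ≤ E / (E + 1)) {ρ σ : H →L[ℂ] H} (hρ : IsState b ρ) (hσ : IsState b σ)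
    (hρE : energy b ρ ≤ ENNReal.ofReal E) (h : traceNorm b (ρ - σ) / 2 ≤ ENNReal.ofReal ε) :
    vonNeumannEntropy b ρ ≤ vonNeumannEntropy b σ
      + ENNReal.ofReal (binEntropy ε + E * binEntropy (ε / E)) := by
  obtain ⟨p, f, hpf, hp⟩ := hρ.exists_isSortedSpectrum
  obtain ⟨q, g, hqg, hq⟩ := hσ.exists_isSortedSpectrum
  obtain ⟨hm, hmE⟩ := hpf.summable_and_tsum_le hρ hE.le hρE
  rw [hp, hq]
  refine shannonEntropy_le_add hpf.sorted hqg.sorted hE hε₀ hε₁ hm hmE fun k => ?_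
  have h1 := sum_re_inner_le_add hρ hσ hε₀ h hqg.orthonormal k
  simp only [hqg.re_inner_eq] at h1
  have h2 := hpf.sum_re_inner_le hqg.orthonormal k
  linarith

lemma vonNeumannEntropy_ne_top {b : HilbertBasis ℕ ℂ H} {E : ℝ} (hE : 0 ≤ E) {ρ : H →L[ℂ] H}
    (hρ : IsState b ρ) (hρE : energy b ρ ≤ ENNReal.ofReal E) : vonNeumannEntropy b ρ ≠ ∞ := by
  obtain ⟨p, f, hpf, hp⟩ := hρ.exists_isSortedSpectrum
  rw [hp]
  exact shannonEntropy_ne_top hpf.sorted (hpf.summable_and_tsum_le hρ hE hρE).1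

/-- Ensures that `ENNReal.ofReal` does not clip the bound. -/
lemma binEntropy_bound_nonneg {E ε : ℝ} (hE : 0 < E) (hε₀ : 0 ≤ ε) (hε₁ : ε ≤ E / (E + 1)) :
    0 ≤ binEntropy ε + E * binEntropy (ε / E) := by
  have h1 : ε * (E + 1) ≤ E := (le_div_iff₀ (by linarith)).1 hε₁
  have h2 : ε ≤ 1 := by nlinarith
  have h3 : ε / E ≤ 1 := by rw [div_le_one hE]; nlinarith
  exact add_nonneg (binEntropy_nonneg hε₀ h2)
    (mul_nonneg hE.le (binEntropy_nonneg (by positivity) h3))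

end

section

variable {H : Type u} [NormedAddCommGroup H] [InnerProductSpace ℂ H]

lemma inner_eigenvector_re (b : HilbertBasis ℕ ℂ H) {T : H →L[ℂ] H} {n : ℕ} {c : ℝ}
    (h : T (b n) = (c : ℂ) • b n) : (⟪b n, T (b n)⟫_ℂ).re = c := by
  rw [h, inner_smul_right, inner_self_eq_norm_sq_to_K, b.orthonormal.1 n]
  simp

lemma posTr_eq_tsum (b : HilbertBasis ℕ ℂ H) {T : H →L[ℂ] H} {d : ℕ → ℝ}
    (h : ∀ n, T (b n) = (d n : ℂ) • b n) : posTr b T = ∑' n, ENNReal.ofReal (d n) := by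
  simp only [posTr, inner_eigenvector_re b (h _)]

variable [CompleteSpace H]

/-! ### Diagonal states -/

/-- The operator that is diagonal in the basis `b`, with summable eigenvalues `p`. -/
noncomputable def diagonal (b : HilbertBasis ℕ ℂ H) (p : ℕ → ℝ) : H →L[ℂ] H :=
  ∑' n, (p n : ℂ) • InnerProductSpace.rankOne ℂ (b n) (b n)

/-- The rank one projections have norm 1, so the series defining `diagonal` converges absolutely and
its `tsum` is not the default 0. -/
lemma hasSum_diagonal_apply (b : HilbertBasis ℕ ℂ H) {p : ℕ → ℝ} (hp : Summable p) (x : H) :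
    HasSum (fun n => (p n : ℂ) • ⟪b n, x⟫_ℂ • b n) (diagonal b p x) := by
  have h : Summable fun n => (p n : ℂ) • InnerProductSpace.rankOne ℂ (b n) (b n) := by
    refine Summable.of_norm ?_
    simpa [norm_smul, b.orthonormal.1] using hp.abs
  exact h.hasSum.mapL (ContinuousLinearMap.apply ℂ H x)

lemma diagonal_apply_basis (b : HilbertBasis ℕ ℂ H) {p : ℕ → ℝ} (hp : Summable p) (k : ℕ) :
    diagonal b p (b k) = (p k : ℂ) • b k := by
  refine (hasSum_diagonal_apply b hp (b k)).unique ?_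
  convert hasSum_single k fun n hn => ?_ using 1
  · rw [inner_self_eq_norm_sq_to_K, b.orthonormal.1 k]; simp
  · rw [b.orthonormal.inner_eq_zero hn, zero_smul, smul_zero]

lemma isPositive_diagonal (b : HilbertBasis ℕ ℂ H) {p : ℕ → ℝ} (hp : Summable p)
    (hp0 : ∀ n, 0 ≤ p n) : (diagonal b p).IsPositive := by
  rw [ContinuousLinearMap.isPositive_iff_complex]
  intro x
  have h1 : HasSum (fun n => ((p n * ‖⟪b n, x⟫_ℂ‖ ^ 2 : ℝ) : ℂ)) ⟪x, diagonal b p x⟫_ℂ := by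
    have h2 := (hasSum_diagonal_apply b hp x).mapL (innerSL ℂ x)
    have h3 : ∀ n, ⟪x, (p n : ℂ) • ⟪b n, x⟫_ℂ • b n⟫_ℂ
        = ((p n * ‖⟪b n, x⟫_ℂ‖ ^ 2 : ℝ) : ℂ) := fun n => by
      rw [inner_smul_right, inner_smul_right, ← inner_conj_symm x (b n), Complex.mul_conj']
      norm_cast
    simpa only [innerSL_apply_apply, h3] using h2
  have h4 := (Complex.hasSum_ofReal.2 (Complex.hasSum_re h1)).unique
    (by simpa only [Complex.ofReal_re] using h1)
  have h5 := (Complex.hasSum_re h1).nonneg fun n => by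
    simpa only [Complex.ofReal_re] using mul_nonneg (hp0 n) (sq_nonneg _)
  rw [← inner_conj_symm, ← h4]
  simp [h5]

lemma isState_diagonal (b : HilbertBasis ℕ ℂ H) {p : ℕ → ℝ} (hp : HasSum p 1)
    (hp0 : ∀ n, 0 ≤ p n) : IsState b (diagonal b p) where
  pos := isPositive_diagonal b hp.summable hp0
  trace_eq_one := by
    rw [posTr_eq_tsum b (diagonal_apply_basis b hp.summable),
      ← ENNReal.ofReal_tsum_of_nonneg hp0 hp.summable, hp.tsum_eq, ENNReal.ofReal_one]

lemma vonNeumannEntropy_diagonal (b : HilbertBasis ℕ ℂ H) {p : ℕ → ℝ} (hp : Summable p)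
    (hp0 : ∀ n, 0 ≤ p n) : vonNeumannEntropy b (diagonal b p) = shannonEntropy p :=
  posTr_eq_tsum b fun n => cfc_apply_eigenvector (isPositive_diagonal b hp hp0).isSelfAdjoint
    continuous_negMulLog.continuousOn (diagonal_apply_basis b hp n)

lemma energy_diagonal (b : HilbertBasis ℕ ℂ H) {p : ℕ → ℝ} (hp : Summable p)
    (hp0 : ∀ n, 0 ≤ p n) {M : ℝ} (hM : HasSum (fun n : ℕ => n * p n) M) :
    energy b (diagonal b p) = ENNReal.ofReal M := by
  rw [energy_eq_tsum b (isPositive_diagonal b hp hp0), ← hM.tsum_eq,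
    ENNReal.ofReal_tsum_of_nonneg (fun n => mul_nonneg (by positivity) (hp0 n)) hM.summable]
  refine tsum_congr fun n => ?_
  rw [inner_eigenvector_re b (diagonal_apply_basis b hp n), ENNReal.ofReal_mul (by positivity),
    ENNReal.ofReal_natCast]

lemma traceNorm_diagonal_sub (b : HilbertBasis ℕ ℂ H) {p q : ℕ → ℝ} (hp : Summable p)
    (hp0 : ∀ n, 0 ≤ p n) (hq : Summable q) (hq0 : ∀ n, 0 ≤ q n) {d : ℝ}
    (hd : HasSum (fun n => |p n - q n|) d) :
    traceNorm b (diagonal b p - diagonal b q) = ENNReal.ofReal d := by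
  have hsa : IsSelfAdjoint (diagonal b p - diagonal b q) :=
    (isPositive_diagonal b hp hp0).isSelfAdjoint.sub (isPositive_diagonal b hq hq0).isSelfAdjoint
  have h : ∀ n, CFC.abs (diagonal b p - diagonal b q) (b n) = ((|p n - q n| : ℝ) : ℂ) • b n := by
    intro n
    rw [CFC.abs_eq_cfc_norm _ hsa]
    refine cfc_apply_eigenvector (f := fun x => ‖x‖) hsa continuous_norm.continuousOn ?_
    rw [sub_apply, diagonal_apply_basis b hp, diagonal_apply_basis b hq, Complex.ofReal_sub,
      sub_smul]
  rw [traceNorm, posTr_eq_tsum b h, ← hd.tsum_eq,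
    ENNReal.ofReal_tsum_of_nonneg (fun n => abs_nonneg _) hd.summable]

/-! ### The extremal pair -/

/-- The point mass at `0`, the spectrum of the vacuum state. -/
def vacuum : ℕ → ℝ
  | 0 => 1
  | _ + 1 => 0

/-- Mass `1 - ε` at `0`, and a geometric distribution of total mass `ε` on the positive integers,
with mean energy `E`. -/
noncomputable def perturbedVacuum (E ε : ℝ) : ℕ → ℝ
  | 0 => 1 - ε
  | n + 1 => ε ^ 2 / E * (1 - ε / E) ^ n

lemma hasSum_of_succ {u : ℕ → ℝ} {a : ℝ} (h : HasSum (fun n => u (n + 1)) a) :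
    HasSum u (u 0 + a) := by
  rw [add_comm]
  simpa using (hasSum_nat_add_iff (f := u) 1).1 h

lemma vacuum_nonneg (n : ℕ) : 0 ≤ vacuum n := by cases n <;> simp [vacuum]

lemma hasSum_vacuum : HasSum vacuum 1 := by
  simpa [vacuum] using hasSum_of_succ (u := vacuum) (a := 0) (by simp [vacuum])

lemma hasSum_mean_vacuum : HasSum (fun n : ℕ => n * vacuum n) 0 := by
  have : (fun n : ℕ => n * vacuum n) = fun _ => 0 := by ext n; cases n <;> simp [vacuum]
  rw [this]; exact hasSum_zero

lemma shannonEntropy_vacuum : shannonEntropy vacuum = 0 := by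
  refine ENNReal.tsum_eq_zero.2 fun n => ?_
  cases n <;> simp [vacuum]

section

variable {E ε : ℝ}

lemma one_sub_div_pos (hE : 0 < E) (hε : 0 < ε) (hε₁ : ε ≤ E / (E + 1)) : 0 < 1 - ε / E := by
  have h1 : ε * (E + 1) ≤ E := (le_div_iff₀ (by linarith)).1 hε₁
  rw [sub_pos, div_lt_one hE]
  nlinarith

lemma perturbedVacuum_nonneg (hE : 0 < E) (hε : 0 < ε) (hε₁ : ε ≤ E / (E + 1)) (n : ℕ) :
    0 ≤ perturbedVacuum E ε n := by
  have h1 : ε * (E + 1) ≤ E := (le_div_iff₀ (by linarith)).1 hε₁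
  have := one_sub_div_pos hE hε hε₁
  cases n with
  | zero => simp only [perturbedVacuum, sub_nonneg]; nlinarith
  | succ n => simp only [perturbedVacuum]; positivity

lemma hasSum_perturbedVacuum_succ (hE : 0 < E) (hε : 0 < ε) (hε₁ : ε ≤ E / (E + 1)) :
    HasSum (fun n => perturbedVacuum E ε (n + 1)) ε := by
  have h1 := (hasSum_geometric_of_lt_one (one_sub_div_pos hE hε hε₁).le
    (by have := div_pos hε hE; linarith)).mul_left (ε ^ 2 / E)
  rwa [sub_sub_cancel, show ε ^ 2 / E * (ε / E)⁻¹ = ε by field_simp] at h1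

/-- Positions are counted from 1, which lowers the first moment `E` by the mass ε. -/
lemma hasSum_mul_perturbedVacuum_succ (hE : 0 < E) (hε : 0 < ε) (hε₁ : ε ≤ E / (E + 1)) :
    HasSum (fun n : ℕ => (n : ℝ) * perturbedVacuum E ε (n + 1)) (E - ε) := by
  have hx := one_sub_div_pos hE hε hε₁
  have h1 := (hasSum_coe_mul_geometric_of_norm_lt_one (𝕜 := ℝ) (r := 1 - ε / E) (by
    rw [Real.norm_of_nonneg hx.le]; have := div_pos hε hE; linarith)).mul_left (ε ^ 2 / E)
  rw [sub_sub_cancel, show ε ^ 2 / E * ((1 - ε / E) / (ε / E) ^ 2) = E - ε by field_simp] at h1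
  simpa only [perturbedVacuum, mul_left_comm] using h1

lemma hasSum_perturbedVacuum (hE : 0 < E) (hε : 0 < ε) (hε₁ : ε ≤ E / (E + 1)) :
    HasSum (perturbedVacuum E ε) 1 := by
  have h := hasSum_of_succ (hasSum_perturbedVacuum_succ hE hε hε₁)
  rwa [perturbedVacuum, sub_add_cancel] at h

lemma hasSum_mean_perturbedVacuum (hE : 0 < E) (hε : 0 < ε) (hε₁ : ε ≤ E / (E + 1)) :
    HasSum (fun n : ℕ => (n : ℝ) * perturbedVacuum E ε n) E := by
  have h1 := (hasSum_mul_perturbedVacuum_succ hE hε hε₁).add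
    (hasSum_perturbedVacuum_succ hE hε hε₁)
  have h := hasSum_of_succ (u := fun n : ℕ => (n : ℝ) * perturbedVacuum E ε n) (a := E)
    (by simpa [add_mul] using h1)
  simpa using h

lemma hasSum_abs_perturbedVacuum_sub_vacuum (hE : 0 < E) (hε : 0 < ε) (hε₁ : ε ≤ E / (E + 1)) :
    HasSum (fun n => |perturbedVacuum E ε n - vacuum n|) (ε * 2) := by
  have h := hasSum_of_succ (u := fun n => |perturbedVacuum E ε n - vacuum n|) (a := ε) (by
    simpa only [vacuum, sub_zero, abs_of_nonneg (perturbedVacuum_nonneg hE hε hε₁ _)]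
      using hasSum_perturbedVacuum_succ hE hε hε₁)
  have h0 : |perturbedVacuum E ε 0 - vacuum 0| = ε := by
    rw [perturbedVacuum, vacuum, show 1 - ε - 1 = -ε by ring, abs_neg, abs_of_pos hε]
  rwa [h0, ← mul_two] at h

/-- These are the reference weights of the upper bound: their logarithm is affine in the position,
so mass and first moment give the entropy exactly. -/
lemma shannonEntropy_perturbedVacuum (hE : 0 < E) (hε : 0 < ε) (hε₁ : ε ≤ E / (E + 1)) :
    shannonEntropy (perturbedVacuum E ε)
      = ENNReal.ofReal (binEntropy ε + E * binEntropy (ε / E)) := by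
  have hx := one_sub_div_pos hE hε hε₁
  have h1 := ((hasSum_perturbedVacuum_succ hE hε hε₁).mul_left (-log (ε ^ 2 / E))).sub
    ((hasSum_mul_perturbedVacuum_succ hE hε hε₁).mul_left (log (1 - ε / E)))
  have h2 : HasSum (fun n => negMulLog (perturbedVacuum E ε n))
      (negMulLog (1 - ε) + (-log (ε ^ 2 / E) * ε - log (1 - ε / E) * (E - ε))) := by
    refine hasSum_of_succ (u := fun n => negMulLog (perturbedVacuum E ε n)) ?_
    have h3 : ∀ n, negMulLog (perturbedVacuum E ε (n + 1))
        = -log (ε ^ 2 / E) * perturbedVacuum E ε (n + 1)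
          - log (1 - ε / E) * (n * perturbedVacuum E ε (n + 1)) := fun n => by
      simp only [perturbedVacuum, negMulLog]
      rw [log_mul (by positivity) (by positivity), log_pow]
      ring
    simpa only [h3] using h1
  have hp1 : ∀ n, perturbedVacuum E ε n ≤ 1 := fun n =>
    le_hasSum (hasSum_perturbedVacuum hE hε hε₁) n fun i _ => perturbedVacuum_nonneg hE hε hε₁ i
  rw [shannonEntropy, ← ENNReal.ofReal_tsum_of_nonneg (fun n =>
    negMulLog_nonneg (perturbedVacuum_nonneg hE hε hε₁ n) (hp1 n)) h2.summable, h2.tsum_eq,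
    binEntropy_add_mul_binEntropy_div hE hε, negMulLog]
  congr 1
  ring

end

end

end BosonicMode

theorem theorem3p3 {H : Type*} [NormedAddCommGroup H] [InnerProductSpace ℂ H] [CompleteSpace H]
    (b : HilbertBasis ℕ ℂ H) (E : ℝ) (hE : 0 < E)
    (ε : ℝ) (hε₀ : 0 ≤ ε) (hε₁ : ε ≤ E / (E + 1)) :
    (∀ ρ σ : H →L[ℂ] H,
      BosonicMode.IsState b ρ → BosonicMode.IsState b σ →
      BosonicMode.energy b ρ ≤ ENNReal.ofReal E →
      BosonicMode.energy b σ ≤ ENNReal.ofReal E →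
      BosonicMode.traceNorm b (ρ - σ) / 2 ≤ ENNReal.ofReal ε →
        BosonicMode.vonNeumannEntropy b ρ ≠ ∞ ∧
        BosonicMode.vonNeumannEntropy b σ ≠ ∞ ∧
        |(BosonicMode.vonNeumannEntropy b ρ).toReal - (BosonicMode.vonNeumannEntropy b σ).toReal|
          ≤ Real.binEntropy ε + E * Real.binEntropy (ε / E)) ∧
    (∃ ρ σ : H →L[ℂ] H,
      BosonicMode.IsState b ρ ∧ BosonicMode.IsState b σ ∧
      BosonicMode.energy b ρ ≤ ENNReal.ofReal E ∧
      BosonicMode.energy b σ ≤ ENNReal.ofReal E ∧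
      BosonicMode.traceNorm b (ρ - σ) / 2 = ENNReal.ofReal ε ∧
      BosonicMode.vonNeumannEntropy b ρ ≠ ∞ ∧
      BosonicMode.vonNeumannEntropy b σ ≠ ∞ ∧
      |(BosonicMode.vonNeumannEntropy b ρ).toReal - (BosonicMode.vonNeumannEntropy b σ).toReal|
        = Real.binEntropy ε + E * Real.binEntropy (ε / E)) := by
  open BosonicMode in
  have hB := binEntropy_bound_nonneg hE hε₀ hε₁
  refine ⟨fun ρ σ hρ hσ hρE hσE h => ?_, ?_⟩
  · have hρt := vonNeumannEntropy_ne_top hE.le hρ hρE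
    have hσt := vonNeumannEntropy_ne_top hE.le hσ hσE
    have key : ∀ {x y : ℝ≥0∞} {B : ℝ}, y ≠ ∞ → 0 ≤ B → x ≤ y + ENNReal.ofReal B →
        x.toReal ≤ y.toReal + B := fun {x y B} hy hB hxy => by
      have h1 := ENNReal.toReal_mono (ENNReal.add_ne_top.2 ⟨hy, ENNReal.ofReal_ne_top⟩) hxy
      rwa [ENNReal.toReal_add hy ENNReal.ofReal_ne_top, ENNReal.toReal_ofReal hB] at h1
    have h1 := key hσt hB (vonNeumannEntropy_le_add hE hε₀ hε₁ hρ hσ hρE h)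
    have h2 := key hρt hB (vonNeumannEntropy_le_add hE hε₀ hε₁ hσ hρ hσE
      (by rwa [traceNorm_sub_comm]))
    exact ⟨hρt, hσt, abs_sub_le_iff.2 ⟨by linarith, by linarith⟩⟩
  · have hv := isState_diagonal b hasSum_vacuum vacuum_nonneg
    have hvE : energy b (diagonal b vacuum) ≤ ENNReal.ofReal E := by
      rw [energy_diagonal b hasSum_vacuum.summable vacuum_nonneg hasSum_mean_vacuum]
      simp
    have hvS : vonNeumannEntropy b (diagonal b vacuum) = 0 := by
      rw [vonNeumannEntropy_diagonal b hasSum_vacuum.summable vacuum_nonneg, shannonEntropy_vacuum]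
    -- At `ε = 0` the geometric weights degenerate; the vacuum is paired with itself.
    rcases hε₀.eq_or_lt with rfl | hε
    · refine ⟨_, _, hv, hv, hvE, hvE, ?_, ?_, ?_, ?_⟩
      · simp [traceNorm, posTr]
      · simp [hvS]
      · simp [hvS]
      · simp
    · have hp := hasSum_perturbedVacuum hE hε hε₁
      have hp0 := perturbedVacuum_nonneg hE hε hε₁
      have hpS : vonNeumannEntropy b (diagonal b (perturbedVacuum E ε))
          = ENNReal.ofReal (Real.binEntropy ε + E * Real.binEntropy (ε / E)) := by
        rw [vonNeumannEntropy_diagonal b hp.summable hp0, shannonEntropy_perturbedVacuum hE hε hε₁]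
      refine ⟨diagonal b (perturbedVacuum E ε), diagonal b vacuum, isState_diagonal b hp hp0, hv,
        ?_, hvE, ?_, ?_, ?_, ?_⟩
      · rw [energy_diagonal b hp.summable hp0 (hasSum_mean_perturbedVacuum hE hε hε₁)]
      · rw [traceNorm_diagonal_sub b hp.summable hp0 hasSum_vacuum.summable vacuum_nonneg
          (hasSum_abs_perturbedVacuum_sub_vacuum hE hε hε₁), ENNReal.ofReal_mul hε₀,
          ENNReal.ofReal_ofNat, ENNReal.mul_div_cancel_right two_ne_zero ENNReal.ofNat_ne_top]
      · rw [hpS]; exact ENNReal.ofReal_ne_top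
      · simp [hvS]
      · rw [hpS, hvS, ENNReal.toReal_ofReal hB, ENNReal.toReal_zero, sub_zero, abs_of_nonneg hB]
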